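/- For a finite directed graph $G=(V,E)$ with $E\subseteq V\times V$, two distinct vertices $s\neq t$ of $G$ and an integer $k\ge 0$, let $P^*_k(s,t)$ be the set of all simple directed paths from $s$ to $t$ in $G$ (sequences $s=v_0,v_1,\dots,v_l=t$ of pairwise distinct vertices with $(v_{i-1},v_i)\in E$ for $1\le i\le l$) of length $l\le k$. Let $SPG_k(s,t)$ be the subgraph of $G$ whose vertex set is the union of the vertex sets, and whose edge set is the union of the edge sets, of all the paths in $P^*_k(s,t)$. Theorem. The problem of computing $SPG_k(s,t)$ from $(G,s,t,k)$ is fixed-parameter tractable with respect to the parameter $k$: there are a deterministic algorithm, a computable function $f:\mathbb N\to\mathbb N$ and a constant $c$ such that on every input $(G,s,t,k)$ the algorithm outputs the vertex set and the edge set of $SPG_k(s,t)$ after at most $f(k)\cdot N^c$ steps, where $N$ is the length of the input in binary. (Steps are those of a random access machine with addition and subtraction as its arithmetic operations, each at unit cost; $G$ is given by its adjacency matrix.) -/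

import Mathlib

/-! ### Simple paths in directed graphs and the simple path graph -/

namespace Digraph

variable {V : Type*}

/-- `p = [v₀, v₁, …, v_l]` is a directed path from `s` to `t` in `G`: a vertex sequence with
`v₀ = s`, `v_l = t` and an edge of `G` from each `v_{i-1}` to `v_i`. -/
structure IsPath (G : Digraph V) (s t : V) (p : List V) : Prop where
  head : p.head? = some s
  last : p.getLast? = some t
  edges : p.IsChain G.Adj

/-- The length (number of hops) of the path `[v₀, …, v_l]` is `l`. -/
def pathLength (p : List V) : ℕ := p.length - 1

/-- The vertex set of a path. -/
def pathVerts (p : List V) : Set V := {v | v ∈ p}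

/-- The edge set of a path: the pairs of consecutive vertices. -/
def pathEdges (p : List V) : Set (V × V) := {e | [e.1, e.2] <:+: p}

/-- The simple paths from `s` to `t` in `G` of length at most `k`. -/
def simplePaths (G : Digraph V) (k : ℕ) (s t : V) : Set (List V) :=
  {p | G.IsPath s t p ∧ p.Nodup ∧ pathLength p ≤ k}

/-- The consecutive vertices of a path in `G` are joined by edges of `G`. -/
theorem IsPath.adj {G : Digraph V} {s t : V} {p : List V} (h : G.IsPath s t p) {u v : V}
    (huv : (u, v) ∈ pathEdges p) : G.Adj u v := by
  have h2 : [u, v].IsChain G.Adj := h.edges.infix huv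
  simpa using h2

/-- The endpoints of an edge of a path are vertices of the path. -/
theorem mem_pathVerts_of_mem_pathEdges {p : List V} {u v : V} (h : (u, v) ∈ pathEdges p) :
    u ∈ pathVerts p ∧ v ∈ pathVerts p := by
  have h2 : [u, v] ⊆ p := List.IsInfix.subset h
  exact ⟨h2 (by simp), h2 (by simp)⟩

/-- A subgraph of a directed graph `G`: a set of vertices and a set of edges of `G` between
them. -/
structure Subgraph (G : Digraph V) where
  verts : Set V
  edges : Set (V × V)
  adj : ∀ u v, (u, v) ∈ edges → G.Adj u v
  fst_mem : ∀ u v, (u, v) ∈ edges → u ∈ verts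
  snd_mem : ∀ u v, (u, v) ∈ edges → v ∈ verts

/-- The `k`-hop-constrained `s`-`t` simple path graph of `G`: the union of the vertex sets and the
union of the edge sets of all simple paths from `s` to `t` of length at most `k`. -/
def simplePathGraph (G : Digraph V) (k : ℕ) (s t : V) : G.Subgraph where
  verts := ⋃ p ∈ G.simplePaths k s t, pathVerts p
  edges := ⋃ p ∈ G.simplePaths k s t, pathEdges p
  adj := by
    intro u v h
    simp only [Set.mem_iUnion] at h
    obtain ⟨p, hp, h⟩ := h
    exact hp.1.adj h
  fst_mem := by
    intro u v h
    simp only [Set.mem_iUnion] at h ⊢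
    obtain ⟨p, hp, h⟩ := h
    exact ⟨p, hp, (mem_pathVerts_of_mem_pathEdges h).1⟩
  snd_mem := by
    intro u v h
    simp only [Set.mem_iUnion] at h ⊢
    obtain ⟨p, hp, h⟩ := h
    exact ⟨p, hp, (mem_pathVerts_of_mem_pathEdges h).2⟩

end Digraph

/-! ### Random access machines

The machine has registers `r₀, r₁, …` and a memory with cells `0, 1, …`, both holding natural
numbers. A program is a fixed finite object and mentions finitely many registers; memory is
addressed indirectly, through registers. The only arithmetic is addition and truncated subtraction,
so that the unit-cost measure is polynomially equivalent to Turing machine time. -/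

namespace RAM

/-- A memory configuration of the machine. -/
structure State where
  reg : ℕ → ℕ
  mem : ℕ → ℕ

/-- The elementary instructions. -/
inductive Instr where
  /-- `r_d := n` -/
  | const (d n : ℕ)
  /-- `r_d := r_a` -/
  | copy (d a : ℕ)
  /-- `r_d := r_a + r_b` -/
  | add (d a b : ℕ)
  /-- `r_d := max (r_a - r_b) 0` -/
  | sub (d a b : ℕ)
  /-- `r_d := mem[r_a]` -/
  | load (d a : ℕ)
  /-- `mem[r_a] := r_b` -/
  | store (a b : ℕ)

/-- The effect of an elementary instruction. -/
def Instr.exec : Instr → State → State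
  | const d n, σ => { σ with reg := Function.update σ.reg d n }
  | copy d a, σ => { σ with reg := Function.update σ.reg d (σ.reg a) }
  | add d a b, σ => { σ with reg := Function.update σ.reg d (σ.reg a + σ.reg b) }
  | sub d a b, σ => { σ with reg := Function.update σ.reg d (σ.reg a - σ.reg b) }
  | load d a, σ => { σ with reg := Function.update σ.reg d (σ.mem (σ.reg a)) }
  | store a b, σ => { σ with mem := Function.update σ.mem (σ.reg a) (σ.reg b) }

/-- Programs: instructions, sequential composition, `if r ≠ 0 then p else q` and
`while r ≠ 0 do p`. -/
inductive Program where
  | instr (i : Instr)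
  | seq (p q : Program)
  | cond (r : ℕ) (p q : Program)
  | loop (r : ℕ) (p : Program)

/-- `Runs p σ T τ`: the program `p`, started in state `σ`, halts after exactly `T` steps in
state `τ`. Every elementary instruction and every test of a register takes one step. -/
inductive Runs : Program → State → ℕ → State → Prop
  | instr (i : Instr) (σ : State) : Runs (.instr i) σ 1 (i.exec σ)
  | seq {p q : Program} {σ τ υ : State} {m n : ℕ} :
      Runs p σ m τ → Runs q τ n υ → Runs (.seq p q) σ (m + n) υ
  | cond_pos {r : ℕ} {p q : Program} {σ τ : State} {m : ℕ} :
      σ.reg r ≠ 0 → Runs p σ m τ → Runs (.cond r p q) σ (m + 1) τ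
  | cond_zero {r : ℕ} {p q : Program} {σ τ : State} {m : ℕ} :
      σ.reg r = 0 → Runs q σ m τ → Runs (.cond r p q) σ (m + 1) τ
  | loop_pos {r : ℕ} {p : Program} {σ τ υ : State} {m n : ℕ} :
      σ.reg r ≠ 0 → Runs p σ m τ → Runs (.loop r p) τ n υ → Runs (.loop r p) σ (m + n + 1) υ
  | loop_zero {r : ℕ} {p : Program} {σ : State} :
      σ.reg r = 0 → Runs (.loop r p) σ 1 σ

/-- The initial state on the input word `l`: the entries of `l` are in the memory cells
`0, 1, …, l.length - 1`, register `0` holds `l.length`, everything else is `0`. -/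
def initial (l : List ℕ) : State where
  reg := Function.update (fun _ => 0) 0 l.length
  mem := fun i => l.getD i 0

/-- The state `σ` presents the output word `l`: register `0` holds `l.length`, and the entries of
`l` are in the memory cells `0, 1, …, l.length - 1`. -/
def State.Outputs (σ : State) (l : List ℕ) : Prop :=
  σ.reg 0 = l.length ∧ ∀ i (h : i < l.length), σ.mem i = l[i]

end RAM

/-! ### Fixed-parameter tractability -/

/-- The size of a word of natural numbers: its number of binary digits, with one separator for each
entry. -/
def wordSize (l : List ℕ) : ℕ := (l.map fun w => Nat.size w + 1).sum

/-- The problem of computing the word `answer x` from the input word `encode x`, for instances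
`x : α` with parameter `param x`, is fixed-parameter tractable: one (deterministic) program solves
all instances and takes at most `f (param x) * |encode x| ^ c` steps, for a computable function `f`
and a constant `c`. -/
def FixedParameterTractable {α : Type*} (encode : α → List ℕ) (param : α → ℕ)
    (answer : α → List ℕ) : Prop :=
  ∃ (P : RAM.Program) (f : ℕ → ℕ) (c : ℕ), Computable f ∧
    ∀ x : α, ∃ (T : ℕ) (τ : RAM.State),
      RAM.Runs P (RAM.initial (encode x)) T τ ∧ τ.Outputs (answer x) ∧
        T ≤ f (param x) * wordSize (encode x) ^ c

/-! ### The generation problem -/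

/-- An instance of simple path graph generation: a finite directed graph `G`, two distinct vertices
`s` and `t`, and a hop constraint `k`. -/
structure SPGInstance where
  n : ℕ
  G : Digraph (Fin n)
  s : Fin n
  t : Fin n
  s_ne_t : s ≠ t
  k : ℕ

open Classical in
/-- The truth value of a proposition as a bit. -/
noncomputable def propBit (P : Prop) : ℕ := if P then 1 else 0

/-- The bits of a set of vertices. -/
noncomputable def vertexBits {n : ℕ} (S : Set (Fin n)) : List ℕ :=
  (List.finRange n).map fun v => propBit (v ∈ S)

/-- The adjacency matrix of a set of edges, row by row. -/
noncomputable def edgeBits {n : ℕ} (E : Set (Fin n × Fin n)) : List ℕ :=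
  (List.finRange n).flatMap fun u => (List.finRange n).map fun v => propBit ((u, v) ∈ E)

namespace SPGInstance

/-- The input word of an instance: the number of vertices, `s`, `t`, `k` and the adjacency matrix
of `G`. -/
noncomputable def encode (x : SPGInstance) : List ℕ :=
  [x.n, (x.s : ℕ), (x.t : ℕ), x.k] ++ edgeBits {e | x.G.Adj e.1 e.2}

/-- The output word of an instance: the vertex set and the adjacency matrix of the simple path
graph. -/
noncomputable def answer (x : SPGInstance) : List ℕ :=
  vertexBits (x.G.simplePathGraph x.k x.s x.t).verts ++
    edgeBits (x.G.simplePathGraph x.k x.s x.t).edges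

end SPGInstance

/-! ### Time-bounded execution of programs -/

/-! The algorithm is derandomized colour coding. Give every vertex a class in `0, …, k` and keep
only the edges along which the class rises by exactly one. Every path in this layered graph is
simple and has at most `k` edges, so if `u` is reachable from `s`, `v` reaches `t` and `(u, v)` is a
layered edge, then gluing yields a path of `simplePaths`, with no disjointness to check
(`Digraph.mem_edges_of_layered`). Conversely, a simple path of length at most `k` is detected as
soon as its `i`-th vertex has class `i` for every `i`. It remains to run through few class
assignments such that every short simple path is detected by one of them.

An assignment is given by a modulus `q` and residues `c 0, …, c k`: a vertex `v` goes to the least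
`i` with `v % q = c i` (and keeps its old class if there is none). It can be made to fit a path
whenever `q` separates the at most `k + 1` vertices of the path. Such a `q` exists with `q ≤ B = 2 *
(L * (k + 1)² + 4)`, where `n ≤ 2 ^ L` (`exists_mod_injOn`): the product of all differences is too
small to be divisible by every number up to `B`. Hence `W = B ^ (k + 2)` assignments suffice, coded
by the numbers below `W` in base `B`.

Division is repeated subtraction, so a round costs up to a multiple of `W`, and the total is `W²`
times a polynomial. Since `B` is of order `k² log n`, this contains the factor `(log n) ^ (2k + 4)`,
and `a ^ g ≤ g ^ g * 2 ^ a` bounds that by a function of `k` times `O(n)` (`cost_le`). Correctness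
is proved for abstract arrays (`Arrays.sound_final`, `Arrays.final_path`); the `halts_` lemmas show
that the machine simulates them within the stated time. -/

/-- `iterDown g N a` applies `g (N - 1)`, …, `g 1`, `g 0` to `a`, in this order. -/
def iterDown {S : Type*} (g : ℕ → S → S) : ℕ → S → S
  | 0, a => a
  | N + 1, a => iterDown g N (g N a)

theorem iterDown_preserves {S : Type*} {g : ℕ → S → S} {Q : S → Prop} {N : ℕ}
    (h : ∀ j < N, ∀ a, Q a → Q (g j a)) {a : S} (ha : Q a) : Q (iterDown g N a) := by
  induction N generalizing a with
  | zero => exact ha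
  | succ N ih => exact ih (fun j hj => h j (by omega)) (h N (by omega) a ha)

/-- The pattern of all completeness arguments: `P` is an invariant up to the decisive step `j`,
which turns it into `Q`, and `Q` is never lost afterwards. The order of the other steps is
irrelevant. -/
theorem iterDown_reaches {S : Type*} {g : ℕ → S → S} {P Q : S → Prop} {N : ℕ}
    (hP : ∀ j < N, ∀ a, P a → P (g j a)) (hQ : ∀ j < N, ∀ a, Q a → Q (g j a)) {j : ℕ} (hj : j < N)
    (hPQ : ∀ a, P a → Q (g j a)) {a : S} (ha : P a) : Q (iterDown g N a) := by
  induction N generalizing a with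
  | zero => omega
  | succ N ih =>
    rcases Nat.lt_succ_iff_lt_or_eq.1 hj with h | rfl
    · exact ih (fun i hi => hP i (by omega)) (fun i hi => hQ i (by omega)) h
        (hP N (by omega) a ha)
    · rw [iterDown]
      exact iterDown_preserves (Q := Q) (fun i hi => hQ i (by omega)) (hPQ a ha)

namespace RAM

/-- Started in `σ`, the program `p` halts after at most `b` steps in a state satisfying `Q`. -/
def Halts (p : Program) (σ : State) (b : ℕ) (Q : State → Prop) : Prop :=
  ∃ T τ, Runs p σ T τ ∧ T ≤ b ∧ Q τ

theorem Halts.mono {p : Program} {σ : State} {b b' : ℕ} {Q Q' : State → Prop}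
    (h : Halts p σ b Q) (hb : b ≤ b') (hQ : ∀ τ, Q τ → Q' τ) : Halts p σ b' Q' := by
  obtain ⟨T, τ, h1, h2, h3⟩ := h
  exact ⟨T, τ, h1, h2.trans hb, hQ τ h3⟩

theorem Halts.seq {p q : Program} {σ : State} {b b' : ℕ} {P Q : State → Prop}
    (h : Halts p σ b P) (h' : ∀ τ, P τ → Halts q τ b' Q) : Halts (.seq p q) σ (b + b') Q := by
  obtain ⟨T, τ, h1, h2, h3⟩ := h
  obtain ⟨T', υ, h4, h5, h6⟩ := h' τ h3
  exact ⟨T + T', υ, h1.seq h4, by omega, h6⟩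

theorem Halts.cond {p q : Program} {r : ℕ} {σ : State} {b : ℕ} {Q : State → Prop}
    (hp : σ.reg r ≠ 0 → Halts p σ b Q) (hq : σ.reg r = 0 → Halts q σ b Q) :
    Halts (.cond r p q) σ (b + 1) Q := by
  by_cases h : σ.reg r = 0
  · obtain ⟨T, τ, h1, h2, h3⟩ := hq h
    exact ⟨T + 1, τ, .cond_zero h h1, by omega, h3⟩
  · obtain ⟨T, τ, h1, h2, h3⟩ := hp h
    exact ⟨T + 1, τ, .cond_pos h h1, by omega, h3⟩

/-- A straight-line program. -/
def block : Instr → List Instr → Program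
  | i, [] => .instr i
  | i, j :: l => .seq (.instr i) (block j l)

theorem Halts.block {Q : State → Prop} (i : Instr) (l : List Instr) (σ : State)
    (h : Q (l.foldl (fun τ j => j.exec τ) (i.exec σ))) :
    Halts (block i l) σ (l.length + 1) Q := by
  induction l generalizing i σ with
  | nil => exact ⟨1, _, .instr i σ, le_rfl, h⟩
  | cons j l ih =>
    exact (Halts.seq (P := fun τ => τ = i.exec σ) ⟨1, _, .instr i σ, le_rfl, rfl⟩
      (by rintro _ rfl; exact ih j _ h)).mono (by simp; omega) fun _ => id

/-- `if r ≠ 0 then p`. -/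
def when (r : ℕ) (p : Program) : Program := .cond r p (.instr (.copy 1 1))

theorem Halts.when {p : Program} {r : ℕ} {σ : State} {b : ℕ} {Q : State → Prop}
    (hb : 1 ≤ b) (hp : σ.reg r ≠ 0 → Halts p σ b Q) (hq : σ.reg r = 0 → Q σ) :
    Halts (when r p) σ (b + 1) Q := by
  -- The else branch is the no-op `copy 1 1`, which still takes a step; hence `hb`.
  refine Halts.cond hp fun h => ⟨1, _, .instr _ _, hb, ?_⟩
  have : (Instr.copy 1 1).exec σ = σ := by simp [Instr.exec]
  rw [this]; exact hq h

/-- `while r ≠ 0 do (r := r - 1; p)`, where register `1` is expected to hold `1`. -/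
def forDown (r : ℕ) (p : Program) : Program := .loop r (.seq (.instr (.sub r r 1)) p)

/-- Simulation of an abstract loop: `R a σ` says that `σ` represents `a`. The representation must
ignore the counter, and the body must restore it. The counter is decremented before the body, which
therefore sees `N - 1, …, 0`, as in `iterDown`. Test and decrement account for the `2`, the last
test for the `1`. -/
theorem Halts.forDown {S : Type*} {r b : ℕ} {p : Program} {g : ℕ → S → S}
    {R : S → State → Prop} {N : ℕ} (hone : ∀ a σ, R a σ → σ.reg 1 = 1)
    (hreg : ∀ a σ x, R a σ → R a { σ with reg := Function.update σ.reg r x })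
    (hp : ∀ j < N, ∀ a σ, R a σ → σ.reg r = j →
      Halts p σ b fun τ => R (g j a) τ ∧ τ.reg r = j) (a : S) (σ : State) (ha : R a σ)
    (hN : σ.reg r = N) :
    Halts (forDown r p) σ (N * (b + 2) + 1) (R (iterDown g N a)) := by
  induction N generalizing a σ with
  | zero => exact ⟨1, σ, .loop_zero hN, by simp, ha⟩
  | succ N ih =>
    obtain ⟨T, τ, h1, h2, h3, h4⟩ := hp N (by omega) a _ (hreg a σ N ha) (by simp)
    obtain ⟨T', υ, h5, h6, h7⟩ := ih (fun j hj => hp j (by omega)) _ τ h3 h4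
    have h8 : (Instr.sub r r 1).exec σ = { σ with reg := Function.update σ.reg r N } := by
      simp [Instr.exec, hN, hone a σ ha]
    refine ⟨1 + T + T' + 1, υ, .loop_pos (by omega) (.seq (.instr _ _) (by rwa [h8])) h5, ?_, h7⟩
    rw [Nat.succ_mul]
    omega

/-! ### Division and multiplication by loops -/

/-- `r_{m+1} := 0; r_m := r_a; while r_m ≥ r_b do (r_m := r_m - r_b; r_{m+1} := r_{m+1} + 1)`:
division with remainder of `r_a` by `r_b`. -/
def divMod (a b m : ℕ) : Program :=
  .seq (block (.const (m + 1) 0) [.copy m a, .add (m + 2) m 1, .sub (m + 2) (m + 2) b])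
    (.loop (m + 2)
      (block (.sub m m b) [.add (m + 1) (m + 1) 1, .add (m + 2) m 1, .sub (m + 2) (m + 2) b]))

/-- Each subtraction costs five steps, so the time is linear in the quotient, not in its number of
digits. Only registers from `m` on serve as scratch space. -/
theorem halts_divMod {a b m : ℕ} (ha : a < m) (hb : b < m) (hm : 1 < m) (σ : State)
    (h1 : σ.reg 1 = 1) (hpos : 0 < σ.reg b) :
    Halts (divMod a b m) σ (σ.reg a / σ.reg b * 5 + 5) fun τ =>
      τ.mem = σ.mem ∧ (∀ x < m, τ.reg x = σ.reg x) ∧ τ.reg m = σ.reg a % σ.reg b ∧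
        τ.reg (m + 1) = σ.reg a / σ.reg b := by
  -- Invariant at the loop test: remainder `r`, partial quotient `q`, and a guard `r + 1 - r_b` that
  -- is nonzero exactly when `r ≥ r_b`.
  have key : ∀ q r (τ : State), τ.mem = σ.mem → (∀ x < m, τ.reg x = σ.reg x) → τ.reg m = r →
      τ.reg (m + 1) = q → τ.reg (m + 2) = r + 1 - σ.reg b →
      Halts (.loop (m + 2)
        (block (.sub m m b) [.add (m + 1) (m + 1) 1, .add (m + 2) m 1, .sub (m + 2) (m + 2) b]))
        τ (r / σ.reg b * 5 + 1) fun τ =>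
      τ.mem = σ.mem ∧ (∀ x < m, τ.reg x = σ.reg x) ∧ τ.reg m = r % σ.reg b ∧
        τ.reg (m + 1) = q + r / σ.reg b := by
    intro q r
    induction r using Nat.strong_induction_on generalizing q with
    | _ r ih =>
    intro τ t1 t2 t3 t4 t5
    by_cases hr : r < σ.reg b
    · refine ⟨1, τ, .loop_zero (by omega), by omega, t1, t2, ?_, ?_⟩
      · rw [t3, Nat.mod_eq_of_lt hr]
      · rw [t4, Nat.div_eq_of_lt hr, add_zero]
    · have hb2 := t2 b hb
      have h12 := t2 1 hm
      obtain ⟨T, υ, e1, e2, e3, e4, e5, e6, e7⟩ := Halts.block (Q := fun υ => υ.mem = σ.mem ∧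
        (∀ x < m, υ.reg x = σ.reg x) ∧ υ.reg m = r - σ.reg b ∧ υ.reg (m + 1) = q + 1 ∧
        υ.reg (m + 2) = r - σ.reg b + 1 - σ.reg b)
        (.sub m m b) [.add (m + 1) (m + 1) 1, .add (m + 2) m 1, .sub (m + 2) (m + 2) b] τ (by
          refine ⟨by simp [Instr.exec, t1], fun x hx => ?_, ?_⟩
          · simp [Instr.exec, Function.update_of_ne, show x ≠ m by omega,
              show x ≠ m + 1 by omega, show x ≠ m + 2 by omega, t2 x hx]
          · simp [Instr.exec, Function.update_of_ne, show 1 ≠ m by omega, show m ≠ 0 by omega,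
              show b ≠ m by omega, show b ≠ m + 1 by omega, show b ≠ m + 2 by omega, hb2, h12,
              t3, t4, h1])
      obtain ⟨T', υ', f1, f2, f3, f4, f5, f6⟩ :=
        ih (r - σ.reg b) (by omega) (q + 1) υ e3 e4 e5 e6 e7
      have hdiv : r / σ.reg b = (r - σ.reg b) / σ.reg b + 1 := by
        rw [Nat.div_eq r, if_pos ⟨hpos, by omega⟩]
      refine ⟨T + T' + 1, υ', .loop_pos (by omega) e1 f1, ?_, f3, f4, ?_, ?_⟩
      · simp at e2
        omega
      · rw [f5, ← Nat.mod_eq_sub_mod (by omega)]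
      · omega
  refine ((Halts.block (Q := fun υ => υ.mem = σ.mem ∧
        (∀ x < m, υ.reg x = σ.reg x) ∧ υ.reg m = σ.reg a ∧ υ.reg (m + 1) = 0 ∧
        υ.reg (m + 2) = σ.reg a + 1 - σ.reg b) _ _ σ ?_).seq fun τ hτ =>
        key 0 (σ.reg a) τ hτ.1 hτ.2.1 hτ.2.2.1 hτ.2.2.2.1 hτ.2.2.2.2).mono (by simp; omega) ?_
  · refine ⟨by simp [Instr.exec], fun x hx => ?_, ?_⟩
    · simp [Instr.exec, Function.update_of_ne, show x ≠ m by omega,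
              show x ≠ m + 1 by omega, show x ≠ m + 2 by omega]
    · simp [Instr.exec, Function.update_of_ne, show 1 ≠ m by omega, show m ≠ 0 by omega,
              show b ≠ m by omega, show b ≠ m + 1 by omega, show b ≠ m + 2 by omega,
              h1, show a ≠ m + 1 by omega]
  · intro τ hτ
    simpa using hτ

/-- `r_m := r_a * r_b`, by repeated addition. -/
def mul (a b m : ℕ) : Program :=
  .seq (block (.const m 0) [.copy (m + 1) b]) (forDown (m + 1) (.instr (.add m m a)))

theorem iterDown_add (c N a : ℕ) : iterDown (fun _ x => x + c) N a = a + c * N := by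
  induction N generalizing a with
  | zero => simp [iterDown]
  | succ N ih => rw [iterDown, ih]; ring

theorem halts_mul {a b m : ℕ} (ha : a < m) (hb : b < m) (hm : 1 < m) (σ : State)
    (h1 : σ.reg 1 = 1) :
    Halts (mul a b m) σ (σ.reg b * 3 + 3) fun τ =>
      τ.mem = σ.mem ∧ (∀ x < m, τ.reg x = σ.reg x) ∧ τ.reg m = σ.reg a * σ.reg b := by
  refine ((Halts.block (Q := fun τ => (τ.mem = σ.mem ∧ (∀ x < m, τ.reg x = σ.reg x) ∧
    τ.reg m = 0) ∧ τ.reg (m + 1) = σ.reg b) _ _ σ ?_).seq fun τ hτ =>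
    Halts.forDown (g := fun _ x => x + σ.reg a) (b := 1) (R := fun c τ => τ.mem = σ.mem ∧
      (∀ x < m, τ.reg x = σ.reg x) ∧ τ.reg m = c) ?_ ?_ ?_ 0 τ hτ.1 hτ.2).mono ?_ ?_
  · refine ⟨⟨by simp [Instr.exec], fun x hx => ?_, ?_⟩, ?_⟩
    · simp [Instr.exec, Function.update_of_ne, show x ≠ m by omega, show x ≠ m + 1 by omega]
    · simp [Instr.exec]
    · simp [Instr.exec, show b ≠ m by omega]
  · rintro c τ ⟨_, h, _⟩
    rw [h 1 hm, h1]
  · rintro c τ x ⟨h2, h3, h4⟩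
    refine ⟨h2, fun y hy => ?_, ?_⟩
    · simp [Function.update_of_ne, show y ≠ m + 1 by omega, h3 y hy]
    · simp [h4]
  · rintro j - c τ ⟨h2, h3, h4⟩ h5
    refine ⟨1, _, .instr _ _, le_rfl, ⟨h2, fun y hy => ?_, ?_⟩, ?_⟩
    · simp [Instr.exec, Function.update_of_ne, show y ≠ m by omega, h3 y hy]
    · simp [Instr.exec, h4, h3 a ha]
    · simp [Instr.exec, h5]
  · simp; omega
  · rintro τ ⟨h2, h3, h4⟩
    refine ⟨h2, h3, ?_⟩
    rw [h4, iterDown_add, zero_add]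

end RAM

/-! ### A modulus that separates few numbers -/

theorem Nat.two_pow_lt_centralBinom {m : ℕ} (hm : 4 ≤ m) : 2 ^ m < m.centralBinom := by
  have h1 := Nat.four_pow_lt_mul_centralBinom m hm
  have h2 : m < 2 ^ m := Nat.lt_two_pow_self
  have h3 : (4 : ℕ) ^ m = 2 ^ m * 2 ^ m := by norm_num [← mul_pow]
  by_contra! h
  have : m * m.centralBinom ≤ 2 ^ m * 2 ^ m := Nat.mul_le_mul h2.le h
  omega

/-- A positive number below the `m`-th central binomial coefficient is not divisible by all the
numbers up to `2 * m`. -/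
theorem Nat.exists_not_dvd_of_lt_centralBinom {m d : ℕ} (hm : 0 < m) (hd : 0 < d)
    (h : d < m.centralBinom) : ∃ q, 0 < q ∧ q ≤ 2 * m ∧ ¬ q ∣ d := by
  by_contra! H
  refine absurd (Nat.le_of_dvd hd ?_) (not_le.2 h)
  refine (Nat.factorization_prime_le_iff_dvd m.centralBinom_ne_zero hd.ne').1 fun p hp => ?_
  -- Every prime power exactly dividing `(2m choose m)` is at most `2m`, so by `H` it divides `d`;
  -- hence the whole coefficient would divide `d`.
  refine (hp.pow_dvd_iff_le_factorization hd.ne').1 (H _ (pow_pos hp.pos _) ?_)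
  rw [Nat.centralBinom_eq_two_mul_choose]
  exact Nat.pow_factorization_choose_le (by omega)

/-- A modulus fails to separate `S` only if it divides one of the differences, hence their product
`d`. There are at most `K * K` differences, each at most `2 ^ L`, so `d` lies below a central
binomial coefficient and some small `q` does not divide it. -/
theorem exists_mod_injOn {L K : ℕ} {S : Finset ℕ} (hS : ∀ x ∈ S, x ≤ 2 ^ L) (hK : S.card ≤ K) :
    ∃ q, 0 < q ∧ q ≤ 2 * (L * (K * K) + 4) ∧ Set.InjOn (· % q) S := by
  set I := (S ×ˢ S).filter fun z => z.1 < z.2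
  set d := ∏ z ∈ I, (z.2 - z.1)
  have hd : 0 < d := Finset.prod_pos fun z hz => by
    have := (Finset.mem_filter.1 hz).2
    omega
  have hd2 : d ≤ 2 ^ (L * (K * K)) := by
    calc d ≤ ∏ _z ∈ I, 2 ^ L := Finset.prod_le_prod' fun z hz => by
            have := hS z.2 (Finset.mem_product.1 (Finset.mem_filter.1 hz).1).2
            omega
      _ = 2 ^ (L * I.card) := by rw [Finset.prod_const, pow_mul]
      _ ≤ 2 ^ (L * (K * K)) := by
            refine Nat.pow_le_pow_right two_pos (Nat.mul_le_mul le_rfl ?_)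
            calc I.card ≤ (S ×ˢ S).card := Finset.card_filter_le _ _
              _ = S.card * S.card := Finset.card_product _ _
              _ ≤ K * K := Nat.mul_le_mul hK hK
  -- The summand `4` secures the hypothesis of `Nat.two_pow_lt_centralBinom`.
  obtain ⟨q, hq, hq2, hqd⟩ := Nat.exists_not_dvd_of_lt_centralBinom
    (m := L * (K * K) + 4) (by omega) hd
    ((hd2.trans (Nat.pow_le_pow_right two_pos (by omega))).trans_lt
      (Nat.two_pow_lt_centralBinom (by omega)))
  have key : ∀ x ∈ S, ∀ y ∈ S, x < y → x % q ≠ y % q := by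
    intro x hx y hy hxy h
    refine hqd (((Nat.modEq_iff_dvd' hxy.le).1 h).trans ?_)
    exact Finset.dvd_prod_of_mem (fun z : ℕ × ℕ => z.2 - z.1) (a := (x, y))
      (Finset.mem_filter.2 ⟨Finset.mem_product.2 ⟨hx, hy⟩, hxy⟩)
  refine ⟨q, hq, hq2, fun x hx y hy h => ?_⟩
  by_contra hne
  rcases Nat.lt_or_gt_of_ne hne with h1 | h1
  · exact key x hx y hy h1 h
  · exact key y hy x hx h1 h.symm

/-! ### Layered paths -/

namespace Digraph

variable {V : Type*} {G : Digraph V} {s t u v : V} {p q : List V}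

theorem IsPath.singleton (G : Digraph V) (s : V) : G.IsPath s s [s] := ⟨rfl, rfl, by simp⟩

theorem IsPath.append (hp : G.IsPath s u p) (hq : G.IsPath v t q) (h : G.Adj u v) :
    G.IsPath s t (p ++ q) := by
  refine ⟨by simp [hp.head], by simp [hq.last], ?_⟩
  refine List.isChain_append.2 ⟨hp.edges, hq.edges, ?_⟩
  simpa [hp.last, hq.head] using h

theorem IsPath.infix_append (hp : G.IsPath s u p) (hq : G.IsPath v t q) :
    [u, v] <:+: p ++ q := by
  obtain ⟨p', rfl⟩ := List.getLast?_eq_some_iff.1 hp.last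
  obtain ⟨q', rfl⟩ := List.head?_eq_some_iff.1 hq.head
  exact ⟨p', q', by simp⟩

/-- The edges of `G` along which `c` increases by one. -/
def layered (G : Digraph V) (c : V → ℕ) : Digraph V where
  Adj u v := G.Adj u v ∧ c v = c u + 1

/-- The values of `c` strictly increase along a layered path, so its vertices are distinct, and only
`k + 1` values are available. -/
theorem IsPath.mem_simplePaths {c : V → ℕ} {k : ℕ} (hc : ∀ v, c v ≤ k)
    (hp : (G.layered c).IsPath s t p) : p ∈ G.simplePaths k s t := by
  have h1 : p.Pairwise fun u v => c u < c v := by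
    have : p.IsChain fun u v => c u < c v := hp.edges.imp fun u v h => by have := h.2; omega
    have : IsTrans V fun u v => c u < c v := ⟨fun _ _ _ => lt_trans⟩
    exact List.isChain_iff_pairwise.1 ‹_›
  have h2 : (p.map c).Nodup :=
    List.pairwise_map.2 (h1.imp fun h => h.ne)
  refine ⟨⟨hp.head, hp.last, hp.edges.imp fun u v h => h.1⟩, h2.of_map, ?_⟩
  have h3 : (p.map c).toFinset ⊆ Finset.range (k + 1) := by
    intro i hi
    obtain ⟨v, -, rfl⟩ := List.mem_map.1 (List.mem_toFinset.1 hi)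
    exact Finset.mem_range.2 (Nat.lt_succ_of_le (hc v))
  have h4 := Finset.card_le_card h3
  rw [List.toFinset_card_of_nodup h2, List.length_map, Finset.card_range] at h4
  unfold pathLength
  omega

theorem mem_edges_of_layered {c : V → ℕ} {k : ℕ} (hc : ∀ v, c v ≤ k)
    (hp : (G.layered c).IsPath s u p) (hq : (G.layered c).IsPath v t q)
    (h : (G.layered c).Adj u v) : (u, v) ∈ (G.simplePathGraph k s t).edges :=
  Set.mem_biUnion (IsPath.mem_simplePaths hc (hp.append hq h)) (hp.infix_append hq)

end Digraph

/-! ### The algorithm on abstract arrays -/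

/-- The working arrays: a class for every vertex, flags for the vertices found to be reachable from
`s` and for those found to reach `t`, and the output bits of the vertices and edges. -/
structure Arrays where
  cls : ℕ → ℕ
  fwd : ℕ → ℕ
  bwd : ℕ → ℕ
  vert : ℕ → ℕ
  edge : ℕ → ℕ

namespace Arrays

open Function

/-- Mark the edge with number `e` and its endpoints, if it is known to be on a layered path. -/
def mark (n e : ℕ) (A : Arrays) : Arrays :=
  if A.fwd (e / n) ≠ 0 ∧ A.bwd (e % n) ≠ 0 then
    { A with
      vert := update (update A.vert (e / n) 1) (e % n) 1
      edge := update A.edge e 1 }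
  else A

/-- Move forward reachability along the edge with number `e`. -/
def pushFwd (n e : ℕ) (A : Arrays) : Arrays :=
  if A.fwd (e / n) ≠ 0 then { A with fwd := update A.fwd (e % n) 1 } else A

/-- Move backward reachability along the edge with number `e`. -/
def pushBwd (n e : ℕ) (A : Arrays) : Arrays :=
  if A.bwd (e % n) ≠ 0 then { A with bwd := update A.bwd (e / n) 1 } else A

/-- Process the pair of vertices with number `e = u * n + v`; `adj` is the adjacency matrix. -/
def relax (n : ℕ) (adj : ℕ → ℕ) (e : ℕ) (A : Arrays) : Arrays :=
  if adj e ≠ 0 then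
    if A.cls (e % n) = A.cls (e / n) + 1 then mark n e (pushBwd n e (pushFwd n e A)) else A
  else A

/-- Process all pairs of vertices, `k + 1` times. -/
def sweeps (n : ℕ) (adj : ℕ → ℕ) (k : ℕ) (A : Arrays) : Arrays :=
  iterDown (fun _ => iterDown (relax n adj) (n * n)) (k + 1) A

/-- Clear the flags of `v`. -/
def clear (v : ℕ) (A : Arrays) : Arrays :=
  { A with fwd := update A.fwd v 0, bwd := update A.bwd v 0 }

/-- Initialize the reachability flags. -/
def reset (n s t : ℕ) (A : Arrays) : Arrays :=
  let A' := iterDown clear n A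
  { A' with fwd := update A'.fwd s 1, bwd := update A'.bwd t 1 }

/-- Put `v` into class `i` if it is `c` modulo `p`. -/
def assignOne (p c i v : ℕ) (A : Arrays) : Arrays :=
  if v % p = c then { A with cls := update A.cls v i } else A

/-- Assign classes according to the base `B` digits of a number. -/
def decode (n B p i : ℕ) (z : ℕ × Arrays) : ℕ × Arrays :=
  (z.1 / B, iterDown (assignOne p (z.1 % B) i) n z.2)

/-- The round of the algorithm for the class assignment with number `w`. -/
def round (n s t k B : ℕ) (adj : ℕ → ℕ) (w : ℕ) (A : Arrays) : Arrays :=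
  sweeps n adj k (reset n s t (iterDown (decode n B (w % B + 1)) (k + 1) (w / B, A)).2)

/-- The arrays at the start. -/
def zero : Arrays := ⟨0, 0, 0, 0, 0⟩

/-- The arrays after all rounds. -/
def final (n s t k B : ℕ) (adj : ℕ → ℕ) : Arrays :=
  iterDown (round n s t k B adj) (B ^ (k + 2)) zero

/-! ### Growth of the flags -/

/-- `A'` has the classes of `A` and at least the flags of `A`. -/
structure Grows (A A' : Arrays) : Prop where
  cls : A'.cls = A.cls
  fwd : ∀ v, A.fwd v ≠ 0 → A'.fwd v ≠ 0
  bwd : ∀ v, A.bwd v ≠ 0 → A'.bwd v ≠ 0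
  vert : ∀ v, A.vert v = 1 → A'.vert v = 1
  edge : ∀ v, A.edge v = 1 → A'.edge v = 1

theorem Grows.refl (A : Arrays) : Grows A A :=
  ⟨rfl, fun _ => id, fun _ => id, fun _ => id, fun _ => id⟩

theorem Grows.trans {A A' A'' : Arrays} (h : Grows A A') (h' : Grows A' A'') : Grows A A'' :=
  ⟨h'.cls.trans h.cls, fun v hv => h'.fwd v (h.fwd v hv), fun v hv => h'.bwd v (h.bwd v hv),
    fun v hv => h'.vert v (h.vert v hv), fun v hv => h'.edge v (h.edge v hv)⟩

theorem grows_pushFwd (n e : ℕ) (A : Arrays) : Grows A (pushFwd n e A) := by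
  unfold pushFwd
  split_ifs
  · refine ⟨rfl, fun v hv => ?_, fun _ => id, fun _ => id, fun _ => id⟩
    simp only [update_apply]; split_ifs <;> simp_all
  · exact .refl A

theorem grows_pushBwd (n e : ℕ) (A : Arrays) : Grows A (pushBwd n e A) := by
  unfold pushBwd
  split_ifs
  · refine ⟨rfl, fun _ => id, fun v hv => ?_, fun _ => id, fun _ => id⟩
    simp only [update_apply]; split_ifs <;> simp_all
  · exact .refl A

theorem grows_mark (n e : ℕ) (A : Arrays) : Grows A (mark n e A) := by
  unfold mark
  split_ifs
  · refine ⟨rfl, fun _ => id, fun _ => id, fun v hv => ?_, fun v hv => ?_⟩ <;>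
    · simp only [update_apply]; split_ifs <;> simp_all
  · exact .refl A

theorem grows_relax (n : ℕ) (adj : ℕ → ℕ) (e : ℕ) (A : Arrays) : Grows A (relax n adj e A) := by
  unfold relax
  split_ifs
  · exact ((grows_pushFwd n e A).trans (grows_pushBwd n e _)).trans (grows_mark n e _)
  all_goals exact .refl A

theorem grows_iterDown {g : ℕ → Arrays → Arrays} (hg : ∀ j A, Grows A (g j A)) (N : ℕ)
    (A : Arrays) : Grows A (iterDown g N A) :=
  iterDown_preserves (Q := Grows A) (fun j _ A' h => h.trans (hg j A')) (.refl A)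

theorem grows_sweeps (n : ℕ) (adj : ℕ → ℕ) (k : ℕ) (A : Arrays) : Grows A (sweeps n adj k A) :=
  grows_iterDown (fun _ => grows_iterDown (grows_relax n adj) _) _ A

theorem relax_spec {n : ℕ} {adj : ℕ → ℕ} {e : ℕ} {A : Arrays} (he : adj e ≠ 0)
    (hc : A.cls (e % n) = A.cls (e / n) + 1) :
    (A.fwd (e / n) ≠ 0 → (relax n adj e A).fwd (e % n) ≠ 0) ∧
    (A.bwd (e % n) ≠ 0 → (relax n adj e A).bwd (e / n) ≠ 0) ∧
    (A.fwd (e / n) ≠ 0 → A.bwd (e % n) ≠ 0 → (relax n adj e A).edge e = 1 ∧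
      (relax n adj e A).vert (e / n) = 1 ∧ (relax n adj e A).vert (e % n) = 1) := by
  rw [relax, if_pos he, if_pos hc]
  refine ⟨fun h => (grows_mark _ _ _).fwd _ ((grows_pushBwd _ _ _).fwd _ ?_), fun h =>
    (grows_mark _ _ _).bwd _ ?_, fun h1 h2 => ?_⟩
  · simp [pushFwd, h]
  · have := (grows_pushFwd n e A).bwd _ h
    simp [pushBwd, this]
  · have h3 := (grows_pushBwd n e _).fwd _ ((grows_pushFwd n e A).fwd _ h1)
    have h4 := (grows_pushBwd n e _).bwd _ ((grows_pushFwd n e A).bwd _ h2)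
    rw [mark, if_pos ⟨h3, h4⟩]
    simp [update_apply]

/-! ### Class assignments -/

theorem assignOne_cls (p c i v u : ℕ) (A : Arrays) :
    (assignOne p c i v A).cls u = if u = v ∧ v % p = c then i else A.cls u := by
  unfold assignOne
  by_cases h : v % p = c <;> simp [h, update_apply]

theorem iterDown_assignOne_cls (p c i n u : ℕ) (A : Arrays) :
    (iterDown (assignOne p c i) n A).cls u = if u < n ∧ u % p = c then i else A.cls u := by
  induction n generalizing A with
  | zero => simp [iterDown]
  | succ n ih =>
    rw [iterDown, ih, assignOne_cls]
    by_cases h : u = n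
    · subst h; simp
    · simp only [h, false_and, if_false, show u < n + 1 ↔ u < n by omega]

/-- The number with base `B` digits `c (N - 1)`, …, `c 1`, `c 0`, the last one leading. -/
def ofDigits (B : ℕ) (c : ℕ → ℕ) : ℕ → ℕ
  | 0 => 0
  | N + 1 => c N + B * ofDigits B c N

theorem ofDigits_lt {B : ℕ} {c : ℕ → ℕ} (hc : ∀ i, c i < B) (N : ℕ) : ofDigits B c N < B ^ N := by
  induction N with
  | zero => simp [ofDigits]
  | succ N ih =>
    have h1 := Nat.mul_le_mul_left B (Nat.succ_le_of_lt ih)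
    have := hc N
    rw [ofDigits, pow_succ']
    rw [Nat.mul_succ] at h1
    omega

/-- The lowest digit is `c N`, the one needed first by a loop that counts down. -/
theorem decode_ofDigits {n B p : ℕ} {c : ℕ → ℕ} (hc : ∀ i, c i < B) (N : ℕ) (A : Arrays) :
    decode n B p N (ofDigits B c (N + 1), A) =
      (ofDigits B c N, iterDown (assignOne p (c N) N) n A) := by
  have h := hc N
  have h1 : ofDigits B c (N + 1) % B = c N := by
    rw [ofDigits, Nat.add_mul_mod_self_left, Nat.mod_eq_of_lt h]
  have h2 : ofDigits B c (N + 1) / B = ofDigits B c N := by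
    rw [ofDigits, Nat.add_mul_div_left _ _ (by omega), Nat.div_eq_of_lt h, zero_add]
  rw [decode, h1, h2]

theorem iterDown_decode_cls_of_ne {n B p : ℕ} {c : ℕ → ℕ} (hc : ∀ i, c i < B) {u : ℕ} (N : ℕ)
    (hu : ∀ i < N, u % p ≠ c i) (A : Arrays) :
    (iterDown (decode n B p) N (ofDigits B c N, A)).2.cls u = A.cls u := by
  induction N generalizing A with
  | zero => rfl
  | succ N ih =>
    rw [iterDown, decode_ofDigits hc, ih (fun i hi => hu i (by omega)), iterDown_assignOne_cls,
      if_neg fun h => hu N (by omega) h.2]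

/-- Smaller indices are processed later and overwrite larger ones, so the least matching index wins;
hence only the `c j` with `j < i` must differ. -/
theorem iterDown_decode_cls {n B p : ℕ} {c : ℕ → ℕ} (hc : ∀ i, c i < B) {u i N : ℕ} (hu : u < n)
    (hi : i < N) (hui : u % p = c i) (huj : ∀ j < i, u % p ≠ c j) (A : Arrays) :
    (iterDown (decode n B p) N (ofDigits B c N, A)).2.cls u = i := by
  induction N generalizing A with
  | zero => omega
  | succ N ih =>
    rw [iterDown, decode_ofDigits hc]
    rcases Nat.lt_succ_iff_lt_or_eq.1 hi with h | rfl
    · exact ih h _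
    · rw [iterDown_decode_cls_of_ne hc _ huj, iterDown_assignOne_cls, if_pos ⟨hu, hui⟩]

theorem decode_snd_of_assignOne {Q : Arrays → Prop}
    (hQ : ∀ p c i v A, Q A → Q (assignOne p c i v A)) {n B p N x : ℕ} {A : Arrays} (h : Q A) :
    Q (iterDown (decode n B p) N (x, A)).2 :=
  iterDown_preserves (Q := fun z : ℕ × Arrays => Q z.2)
    (fun _ _ _ hz => iterDown_preserves (Q := Q) (fun _ _ _ ha => hQ _ _ _ _ _ ha) hz) h

theorem assignOne_vert (p c i v : ℕ) (A : Arrays) : (assignOne p c i v A).vert = A.vert := by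
  unfold assignOne; split_ifs <;> rfl

theorem assignOne_edge (p c i v : ℕ) (A : Arrays) : (assignOne p c i v A).edge = A.edge := by
  unfold assignOne; split_ifs <;> rfl

theorem iterDown_decode_vert (n B p N x : ℕ) (A : Arrays) :
    (iterDown (decode n B p) N (x, A)).2.vert = A.vert :=
  decode_snd_of_assignOne (Q := fun A' => A'.vert = A.vert)
    (fun _ _ _ _ _ h => (assignOne_vert ..).trans h) rfl

theorem iterDown_decode_edge (n B p N x : ℕ) (A : Arrays) :
    (iterDown (decode n B p) N (x, A)).2.edge = A.edge :=
  decode_snd_of_assignOne (Q := fun A' => A'.edge = A.edge)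
    (fun _ _ _ _ _ h => (assignOne_edge ..).trans h) rfl

theorem reset_cls (n s t : ℕ) (A : Arrays) : (reset n s t A).cls = A.cls :=
  iterDown_preserves (g := clear) (Q := fun A' => A'.cls = A.cls) (fun _ _ _ h => h) rfl

theorem reset_vert (n s t : ℕ) (A : Arrays) : (reset n s t A).vert = A.vert :=
  iterDown_preserves (g := clear) (Q := fun A' => A'.vert = A.vert) (fun _ _ _ h => h) rfl

theorem reset_edge (n s t : ℕ) (A : Arrays) : (reset n s t A).edge = A.edge :=
  iterDown_preserves (g := clear) (Q := fun A' => A'.edge = A.edge) (fun _ _ _ h => h) rfl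

theorem iterDown_clear_fwd {n v : ℕ} (hv : v < n) (A : Arrays) :
    (iterDown clear n A).fwd v = 0 ∧ (iterDown clear n A).bwd v = 0 := by
  refine iterDown_reaches (P := fun _ => True)
    (Q := fun A' : Arrays => A'.fwd v = 0 ∧ A'.bwd v = 0) (fun _ _ _ _ => trivial)
    (fun j _ a h => ?_) hv (fun a _ => ?_) trivial
  · simp only [clear, update_apply, h]; simp
  · simp [clear]

theorem reset_fwd {n s t v : ℕ} (hv : v < n) (A : Arrays) (h : (reset n s t A).fwd v ≠ 0) :
    v = s := by
  by_contra h1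
  exact h (by simp [reset, h1, iterDown_clear_fwd hv])

theorem reset_bwd {n s t v : ℕ} (hv : v < n) (A : Arrays) (h : (reset n s t A).bwd v ≠ 0) :
    v = t := by
  by_contra h1
  exact h (by simp [reset, h1, iterDown_clear_fwd hv])

end Arrays

/-! ### Correctness of the algorithm on arrays -/

namespace Arrays

open Function

variable {n : ℕ} {G : Digraph (Fin n)} {s t : Fin n} {k : ℕ} {adj : ℕ → ℕ}

/-- Every output bit that is set belongs to the simple path graph. -/
structure Sound (G : Digraph (Fin n)) (s t : Fin n) (k : ℕ) (A : Arrays) : Prop where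
  cls : ∀ v, A.cls v ≤ k
  vert : ∀ v : Fin n, A.vert v = 0 ∨ A.vert v = 1 ∧ v ∈ (G.simplePathGraph k s t).verts
  edge : ∀ u v : Fin n, A.edge (u * n + v) = 0 ∨
    A.edge (u * n + v) = 1 ∧ (u, v) ∈ (G.simplePathGraph k s t).edges

/-- The edges between consecutive classes. -/
abbrev layers (G : Digraph (Fin n)) (A : Arrays) : Digraph (Fin n) := G.layered fun v => A.cls v

/-- Moreover, every flag that is set is justified by a path. -/
structure SoundFlags (G : Digraph (Fin n)) (s t : Fin n) (k : ℕ) (A : Arrays) : Prop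
    extends Sound G s t k A where
  fwd : ∀ v : Fin n, A.fwd v ≠ 0 → ∃ p, (layers G A).IsPath s v p
  bwd : ∀ v : Fin n, A.bwd v ≠ 0 → ∃ p, (layers G A).IsPath v t p

/-! ### Soundness: marked edges lie on short simple paths -/

theorem SoundFlags.pushFwd {A : Arrays} (h : SoundFlags G s t k A) {u v : Fin n} {e : ℕ}
    (hu : e / n = u) (hv : e % n = v) (huv : (layers G A).Adj u v) :
    SoundFlags G s t k (pushFwd n e A) := by
  unfold Arrays.pushFwd
  rw [hu, hv]
  split_ifs with hc
  · refine ⟨⟨h.cls, h.vert, h.edge⟩, fun w hw => ?_, h.bwd⟩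
    by_cases hwv : w = v
    · subst hwv
      obtain ⟨p, hp⟩ := h.fwd u hc
      exact ⟨_, hp.append (.singleton _ w) huv⟩
    · exact h.fwd w (by simpa [update_apply, Fin.val_inj, hwv] using hw)
  · exact h

theorem SoundFlags.pushBwd {A : Arrays} (h : SoundFlags G s t k A) {u v : Fin n} {e : ℕ}
    (hu : e / n = u) (hv : e % n = v) (huv : (layers G A).Adj u v) :
    SoundFlags G s t k (pushBwd n e A) := by
  unfold Arrays.pushBwd
  rw [hu, hv]
  split_ifs with hc
  · refine ⟨⟨h.cls, h.vert, h.edge⟩, h.fwd, fun w hw => ?_⟩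
    by_cases hwu : w = u
    · subst hwu
      obtain ⟨p, hp⟩ := h.bwd v hc
      exact ⟨_, (Digraph.IsPath.singleton _ w).append hp huv⟩
    · exact h.bwd w (by simpa [update_apply, Fin.val_inj, hwu] using hw)
  · exact h

theorem mul_add_div_mod (u v : Fin n) : (u * n + v : ℕ) / n = u ∧ (u * n + v : ℕ) % n = v := by
  have hn : 0 < n := u.pos
  constructor
  · rw [mul_comm, Nat.mul_add_div hn, Nat.div_eq_of_lt v.2, add_zero]
  · rw [mul_comm, Nat.mul_add_mod, Nat.mod_eq_of_lt v.2]

theorem mul_add_lt (u v : Fin n) : (u * n + v : ℕ) < n * n := by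
  have h1 := Nat.mul_le_mul_right n (Nat.succ_le_of_lt u.2)
  have h2 := v.2
  rw [Nat.succ_mul] at h1
  omega

/-- The flags provide layered paths from `s` to `u` and from `v` to `t`; joined by the layered edge
`(u, v)` they form a short simple path. -/
theorem SoundFlags.mark {A : Arrays} (h : SoundFlags G s t k A) {u v : Fin n} {e : ℕ}
    (hu : e / n = u) (hv : e % n = v) (huv : (layers G A).Adj u v) :
    SoundFlags G s t k (mark n e A) := by
  unfold Arrays.mark
  rw [hu, hv]
  split_ifs with hc
  · obtain ⟨p, hp⟩ := h.fwd u hc.1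
    obtain ⟨q, hq⟩ := h.bwd v hc.2
    have hmem : (u, v) ∈ (G.simplePathGraph k s t).edges :=
      Digraph.mem_edges_of_layered (fun v => h.cls v) hp hq huv
    refine ⟨⟨h.cls, fun w => ?_, fun a b => ?_⟩, h.fwd, h.bwd⟩
    · by_cases hwv : w = v
      · subst hwv
        exact .inr ⟨by simp, (G.simplePathGraph k s t).snd_mem _ _ hmem⟩
      by_cases hwu : w = u
      · subst hwu
        exact .inr ⟨by simp [update_apply], (G.simplePathGraph k s t).fst_mem _ _ hmem⟩
      · simpa [update_apply, Fin.val_inj, hwu, hwv] using h.vert w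
    · by_cases he : (a * n + b : ℕ) = e
      · obtain ⟨h1, h2⟩ := mul_add_div_mod a b
        rw [he] at h1 h2
        obtain rfl : a = u := Fin.ext (h1.symm.trans hu)
        obtain rfl : b = v := Fin.ext (h2.symm.trans hv)
        exact .inr ⟨by simp [he], hmem⟩
      · simpa [update_apply, he] using h.edge a b
  · exact h

theorem SoundFlags.relax (hadj : ∀ u v : Fin n, adj (u * n + v) ≠ 0 ↔ G.Adj u v) {A : Arrays}
    (h : SoundFlags G s t k A) {e : ℕ} (he : e < n * n) : SoundFlags G s t k (relax n adj e A) := by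
  unfold Arrays.relax
  split_ifs with h1 h2
  · let u : Fin n := ⟨e / n, Nat.div_lt_of_lt_mul he⟩
    let v : Fin n := ⟨e % n, Nat.mod_lt _ s.pos⟩
    have huv : (layers G A).Adj u v :=
      ⟨(hadj u v).1 (by rwa [show (u * n + v : ℕ) = e from Nat.div_add_mod' e n]), h2⟩
    have h3 := h.pushFwd (u := u) (v := v) rfl rfl huv
    have c1 := (grows_pushFwd n e A).cls
    have c2 := (grows_pushBwd n e (Arrays.pushFwd n e A)).cls
    have h4 := h3.pushBwd (u := u) (v := v) rfl rfl (by unfold layers; rwa [c1])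
    exact h4.mark (u := u) (v := v) rfl rfl (by unfold layers; rwa [c2, c1])
  all_goals exact h

theorem Sound.round (hadj : ∀ u v : Fin n, adj (u * n + v) ≠ 0 ↔ G.Adj u v) {A : Arrays}
    (h : Sound G s t k A) (B w : ℕ) : Sound G s t k (round n s t k B adj w A) := by
  unfold Arrays.round
  set A' := (iterDown (decode n B (w % B + 1)) (k + 1) (w / B, A)).2 with hA'
  -- A vertex matching no digit keeps its class from an earlier round. This is harmless, since
  -- soundness only needs classes bounded by `k`.
  have h1 : Sound G s t k A' := by
    refine ⟨fun v => ?_, ?_, ?_⟩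
    · refine iterDown_preserves (Q := fun z : ℕ × Arrays => z.2.cls v ≤ k) (fun i hi z hz => ?_)
        (h.cls v)
      rw [decode, iterDown_assignOne_cls]
      split_ifs
      · omega
      · exact hz
    · rw [hA', iterDown_decode_vert]; exact h.vert
    · rw [hA', iterDown_decode_edge]; exact h.edge
  -- Old flags refer to old classes, so `Sound` alone passes between rounds. After the reset, the
  -- only flags are those of `s` and `t`, justified by one-vertex paths.
  have h2 : SoundFlags G s t k (reset n s t A') := by
    refine ⟨⟨?_, ?_, ?_⟩, fun v hv => ?_, fun v hv => ?_⟩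
    · rw [reset_cls]; exact h1.cls
    · rw [reset_vert]; exact h1.vert
    · rw [reset_edge]; exact h1.edge
    · obtain rfl := Fin.ext (reset_fwd v.2 A' hv)
      exact ⟨_, .singleton _ v⟩
    · obtain rfl := Fin.ext (reset_bwd v.2 A' hv)
      exact ⟨_, .singleton _ v⟩
  exact (iterDown_preserves (Q := SoundFlags G s t k) (fun _ _ _ h3 =>
    iterDown_preserves (fun _ he _ h4 => h4.relax hadj he) h3) h2).toSound

/-! ### Completeness: every short simple path is detected -/

/-- The flags known to be set after `r` sweeps, if the vertices of the path `p` are in the classes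
`0, 1, …`. -/
structure Progress (p : List (Fin n)) (r : ℕ) (A : Arrays) : Prop where
  cls : ∀ i (h : i < p.length), A.cls p[i] = i
  fwd : ∀ i (h : i < p.length), i ≤ r → A.fwd p[i] ≠ 0
  bwd : ∀ i (h : i < p.length), p.length ≤ i + 1 + r → A.bwd p[i] ≠ 0

theorem Progress.grows {p : List (Fin n)} {r : ℕ} {A A' : Arrays} (h : Progress p r A)
    (hA : Grows A A') : Progress p r A' :=
  ⟨fun i hi => by rw [hA.cls, h.cls i hi], fun i hi hr => hA.fwd _ (h.fwd i hi hr),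
    fun i hi hr => hA.bwd _ (h.bwd i hi hr)⟩

theorem relax_path (hadj : ∀ u v : Fin n, adj (u * n + v) ≠ 0 ↔ G.Adj u v) {p : List (Fin n)}
    (hp : p.IsChain G.Adj) {r : ℕ} {A : Arrays} (h : Progress p r A) (i : ℕ)
    (hi : i + 1 < p.length) :
    (A.fwd p[i] ≠ 0 → (relax n adj (p[i] * n + p[i + 1]) A).fwd p[i + 1] ≠ 0) ∧
    (A.bwd p[i + 1] ≠ 0 → (relax n adj (p[i] * n + p[i + 1]) A).bwd p[i] ≠ 0) ∧
    (A.fwd p[i] ≠ 0 → A.bwd p[i + 1] ≠ 0 →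
      (relax n adj (p[i] * n + p[i + 1]) A).edge (p[i] * n + p[i + 1]) = 1 ∧
      (relax n adj (p[i] * n + p[i + 1]) A).vert p[i] = 1 ∧
      (relax n adj (p[i] * n + p[i + 1]) A).vert p[i + 1] = 1) := by
  obtain ⟨h1, h2⟩ := mul_add_div_mod p[i] p[i + 1]
  have h3 := relax_spec (n := n) (A := A) ((hadj _ _).2 (List.isChain_iff_getElem.1 hp i hi))
    (by rw [h1, h2, h.cls (i + 1) hi, h.cls i (by omega)])
  rwa [h1, h2] at h3

/-- A sweep meets every edge of `p` at some moment, in whatever order, so both the forward and the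
backward frontier advance by at least one vertex. -/
theorem Progress.sweep (hadj : ∀ u v : Fin n, adj (u * n + v) ≠ 0 ↔ G.Adj u v) {p : List (Fin n)}
    (hp : p.IsChain G.Adj) {r : ℕ} {A : Arrays} (h : Progress p r A) :
    Progress p (r + 1) (iterDown (relax n adj) (n * n) A) := by
  have hg := grows_iterDown (grows_relax n adj) (n * n) A
  have h' := h.grows hg
  refine ⟨h'.cls, fun i hi hr => ?_, fun i hi hr => ?_⟩
  · by_cases h1 : i ≤ r
    · exact h'.fwd i hi h1
    · obtain ⟨i, rfl⟩ : ∃ j, i = j + 1 := ⟨i - 1, by omega⟩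
      exact iterDown_reaches (P := Progress p r) (Q := fun A => A.fwd p[i + 1] ≠ 0)
        (fun j _ A h => h.grows (grows_relax n adj j A))
        (fun j _ A h => (grows_relax n adj j A).fwd _ h) (mul_add_lt p[i] p[i + 1])
        (fun A h => (relax_path hadj hp h i hi).1 (h.fwd i (by omega) (by omega))) h
  · by_cases h1 : p.length ≤ i + 1 + r
    · exact h'.bwd i hi h1
    · exact iterDown_reaches (P := Progress p r) (Q := fun A => A.bwd p[i] ≠ 0)
        (fun j _ A h => h.grows (grows_relax n adj j A))
        (fun j _ A h => (grows_relax n adj j A).bwd _ h) (mul_add_lt p[i] p[i + 1])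
        (fun A h => (relax_path hadj hp h i (by omega)).2.1 (h.bwd (i + 1) (by omega) (by omega))) h

theorem Progress.sweeps (hadj : ∀ u v : Fin n, adj (u * n + v) ≠ 0 ↔ G.Adj u v)
    {p : List (Fin n)} (hp : p.IsChain G.Adj) (hk : p.length ≤ k + 1) {i : ℕ}
    (hi : i + 1 < p.length) {r : ℕ} {A : Arrays} (h : Progress p r A) {j : ℕ} (hj : r + j = k) :
    (sweeps n adj j A).edge (p[i] * n + p[i + 1]) = 1 ∧ (sweeps n adj j A).vert p[i] = 1 ∧
      (sweeps n adj j A).vert p[i + 1] = 1 := by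
  induction j generalizing r A with
  | zero =>
    -- Now `r = k`, and `p` has at most `k + 1` vertices, so all its flags are set; the one
    -- remaining sweep marks its edges.
    refine iterDown_reaches (P := Progress p r)
      (Q := fun A => A.edge (p[i] * n + p[i + 1]) = 1 ∧ A.vert p[i] = 1 ∧ A.vert p[i + 1] = 1)
      (fun j _ A h => h.grows (grows_relax n adj j A))
      (fun j _ A h => ?_) (mul_add_lt p[i] p[i + 1])
      (fun A h => (relax_path hadj hp h i hi).2.2 (h.fwd i _ (by omega))
        (h.bwd (i + 1) _ (by omega))) h
    have hg := grows_relax n adj j A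
    exact ⟨hg.edge _ h.1, hg.vert _ h.2.1, hg.vert _ h.2.2⟩
  | succ j ih => exact ih (h.sweep hadj hp) (by omega)

/-- The number of residues used by the algorithm, where `n ≤ 2 ^ L`. -/
def base (L k : ℕ) : ℕ := 2 * (L * ((k + 1) * (k + 1)) + 4)

theorem exists_round {L : ℕ} (hL : n ≤ 2 ^ L)
    (hadj : ∀ u v : Fin n, adj (u * n + v) ≠ 0 ↔ G.Adj u v)
    {p : List (Fin n)} (hp : p ∈ G.simplePaths k s t) {i : ℕ} (hi : i + 1 < p.length) :
    ∃ w < base L k ^ (k + 2), ∀ A, (round n s t k (base L k) adj w A).edge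
      (p[i] * n + p[i + 1]) = 1 ∧ (round n s t k (base L k) adj w A).vert p[i] = 1 ∧
      (round n s t k (base L k) adj w A).vert p[i + 1] = 1 := by
  obtain ⟨hpath, hnodup, hlen⟩ := hp
  have hk : p.length ≤ k + 1 := by unfold Digraph.pathLength at hlen; omega
  obtain ⟨q, hq, hqB, hinj⟩ := exists_mod_injOn (L := L) (K := k + 1)
    (S := p.toFinset.image Fin.val)
    (fun x hx => by
      obtain ⟨v, -, rfl⟩ := Finset.mem_image.1 hx
      exact v.2.le.trans hL)
    (Finset.card_image_le.trans ((List.toFinset_card_le p).trans hk))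
  change q ≤ base L k at hqB
  set B := base L k
  -- The digits past the end of `p` are arbitrary: a clash with them does no harm because the least
  -- matching index wins.
  let c : ℕ → ℕ := fun i => if h : i < p.length then (p[i] : ℕ) % q else 0
  have hc : ∀ i, c i < B := fun i => by
    simp only [c]
    split_ifs
    · exact (Nat.mod_lt _ hq).trans_le hqB
    · omega
  have hw1 : (q - 1 + B * ofDigits B c (k + 1)) % B = q - 1 := by
    rw [Nat.add_mul_mod_self_left, Nat.mod_eq_of_lt (by omega)]
  have hw2 : (q - 1 + B * ofDigits B c (k + 1)) / B = ofDigits B c (k + 1) := by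
    rw [Nat.add_mul_div_left _ _ (by omega), Nat.div_eq_of_lt (by omega), zero_add]
  -- One digit for the modulus, shifted because `1 ≤ q ≤ B`, and `k + 1` digits for the residues.
  refine ⟨q - 1 + B * ofDigits B c (k + 1), ?_, fun A => ?_⟩
  · have h1 := Nat.mul_le_mul_left B (Nat.succ_le_of_lt (ofDigits_lt hc (k + 1)))
    rw [pow_succ']
    rw [Nat.mul_succ] at h1
    omega
  · rw [round, hw1, hw2, Nat.sub_add_cancel hq]
    refine Progress.sweeps hadj hpath.edges hk hi (r := 0) ⟨fun j hj => ?_, fun j hj hr => ?_,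
      fun j hj hr => ?_⟩ (by omega)
    · rw [reset_cls]
      refine iterDown_decode_cls hc p[j].2 (by omega) (by simp [c, hj]) (fun m hm h => ?_) A
      have hmp : m < p.length := hm.trans hj
      have hmem : ∀ j (hj : j < p.length), ((p[j] : Fin n) : ℕ) ∈
          ((p.toFinset.image Fin.val : Finset ℕ) : Set ℕ) := fun j hj =>
        Finset.mem_coe.2 (Finset.mem_image_of_mem _ (List.mem_toFinset.2 (List.getElem_mem hj)))
      have h1 := hinj (hmem j hj) (hmem m hmp)
        (show ((p[j] : Fin n) : ℕ) % q = ((p[m] : Fin n) : ℕ) % q by simpa [c, hmp] using h)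
      have h2 := (hnodup.getElem_inj_iff).1 (Fin.ext h1)
      omega
    · obtain rfl : j = 0 := by omega
      have h1 : p[0] = s := by
        have := hpath.head
        rw [List.head?_eq_getElem?, List.getElem?_eq_getElem hj] at this
        simpa using this
      simp [reset, h1]
    · obtain rfl : j = p.length - 1 := by omega
      have h1 : p[p.length - 1] = t := by
        have := hpath.last
        rw [List.getLast?_eq_getElem?, List.getElem?_eq_getElem hj] at this
        simpa using this
      simp [reset, h1]

theorem round_mono (s t k B : ℕ) (w : ℕ) (A : Arrays) (v : ℕ) :
    (A.vert v = 1 → (round n s t k B adj w A).vert v = 1) ∧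
      (A.edge v = 1 → (round n s t k B adj w A).edge v = 1) := by
  have hg := grows_sweeps n adj k
    (reset n s t (iterDown (decode n B (w % B + 1)) (k + 1) (w / B, A)).2)
  constructor <;> intro h
  · exact hg.vert v (by rwa [reset_vert, iterDown_decode_vert])
  · exact hg.edge v (by rwa [reset_edge, iterDown_decode_edge])

theorem final_path {L : ℕ} (hL : n ≤ 2 ^ L)
    (hadj : ∀ u v : Fin n, adj (u * n + v) ≠ 0 ↔ G.Adj u v)
    {p : List (Fin n)} (hp : p ∈ G.simplePaths k s t) {i : ℕ} (hi : i + 1 < p.length) :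
    (final n s t k (base L k) adj).edge (p[i] * n + p[i + 1]) = 1 ∧
      (final n s t k (base L k) adj).vert p[i] = 1 ∧
      (final n s t k (base L k) adj).vert p[i + 1] = 1 := by
  obtain ⟨w, hw, h⟩ := exists_round hL hadj hp hi
  exact iterDown_reaches (P := fun _ => True)
    (Q := fun A => A.edge (p[i] * n + p[i + 1]) = 1 ∧ A.vert p[i] = 1 ∧ A.vert p[i + 1] = 1)
    (fun _ _ _ _ => trivial) (fun j _ A h => ⟨(round_mono _ _ _ _ j A _).2 h.1,
      (round_mono _ _ _ _ j A _).1 h.2.1, (round_mono _ _ _ _ j A _).1 h.2.2⟩) hw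
    (fun A _ => h A) trivial

theorem sound_final (hadj : ∀ u v : Fin n, adj (u * n + v) ≠ 0 ↔ G.Adj u v) (B : ℕ) :
    Sound G s t k (final n s t k B adj) :=
  iterDown_preserves (fun w _ _ h => h.round hadj B w)
    ⟨fun _ => Nat.zero_le _, fun _ => .inl rfl, fun _ _ => .inl rfl⟩

theorem final_edge {L : ℕ} (hL : n ≤ 2 ^ L)
    (hadj : ∀ u v : Fin n, adj (u * n + v) ≠ 0 ↔ G.Adj u v) (u v : Fin n) :
    (final n s t k (base L k) adj).edge (u * n + v) =
      propBit ((u, v) ∈ (G.simplePathGraph k s t).edges) := by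
  unfold propBit
  split_ifs with h
  · simp only [Digraph.simplePathGraph, Set.mem_iUnion] at h
    obtain ⟨p, hp, l, r, rfl⟩ := h
    have := (final_path hL hadj hp (i := l.length) (by simp)).1
    simpa using this
  · exact ((sound_final hadj _).edge u v).resolve_right fun h' => h h'.2

/-- Vertices are marked only as endpoints of edges. Since `s ≠ t`, a path has at least one edge, so
each of its vertices is such an endpoint. -/
theorem final_vert {L : ℕ} (hL : n ≤ 2 ^ L)
    (hadj : ∀ u v : Fin n, adj (u * n + v) ≠ 0 ↔ G.Adj u v) (hst : s ≠ t) (v : Fin n) :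
    (final n s t k (base L k) adj).vert v =
      propBit (v ∈ (G.simplePathGraph k s t).verts) := by
  unfold propBit
  split_ifs with h
  · simp only [Digraph.simplePathGraph, Set.mem_iUnion] at h
    obtain ⟨p, hp, hv⟩ := h
    obtain ⟨i, hi, rfl⟩ := List.getElem_of_mem hv
    have hlen : 1 < p.length := by
      by_contra! hlen
      obtain ⟨a, rfl⟩ := List.length_eq_one_iff.1 (show p.length = 1 by omega)
      have h1 := hp.1.head
      have h2 := hp.1.last
      simp at h1 h2
      exact hst (h1.symm.trans h2)
    by_cases h1 : i + 1 < p.length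
    · exact (final_path hL hadj hp h1).2.1
    · obtain ⟨i, rfl⟩ : ∃ j, i = j + 1 := ⟨i - 1, by omega⟩
      exact (final_path hL hadj hp hi).2.2
  · exact ((sound_final hadj _).vert v).resolve_right fun h' => h h'.2

end Arrays

/-! ### The program -/

namespace RAM

open Function

/-- The arrays `A` and the adjacency matrix `adj` are stored in the memory `mem`. -/
structure Rep (n : ℕ) (adj : ℕ → ℕ) (A : Arrays) (mem : ℕ → ℕ) : Prop where
  adj : ∀ e < n * n, mem (4 + e) = adj e
  vert : ∀ v < n, mem (n * n + n + 4 + v) = A.vert v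
  edge : ∀ e < n * n, mem (n * n + 2 * n + 4 + e) = A.edge e
  cls : ∀ v < n, mem (2 * (n * n) + 2 * n + 4 + v) = A.cls v
  fwd : ∀ v < n, mem (2 * (n * n) + 3 * n + 4 + v) = A.fwd v
  bwd : ∀ v < n, mem (2 * (n * n) + 4 * n + 4 + v) = A.bwd v

/-- The values kept in the registers `1, …, 13`. -/
structure Consts (n s t k B : ℕ) (ρ : ℕ → ℕ) : Prop where
  one : ρ 1 = 1
  num : ρ 2 = n
  source : ρ 3 = s
  target : ρ 4 = t
  hops : ρ 5 = k + 1
  nn : ρ 6 = n * n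
  vert : ρ 7 = n * n + n + 4
  edge : ρ 8 = n * n + 2 * n + 4
  cls : ρ 9 = 2 * (n * n) + 2 * n + 4
  fwd : ρ 10 = 2 * (n * n) + 3 * n + 4
  bwd : ρ 11 = 2 * (n * n) + 4 * n + 4
  base : ρ 12 = B
  rounds : ρ 13 = B ^ (k + 2)

variable {n s t k B e : ℕ} {adj : ℕ → ℕ} {A : Arrays} {mem : ℕ → ℕ} {ρ ρ' : ℕ → ℕ} {σ : State}

theorem Consts.congr (h : Consts n s t k B ρ) (h' : ∀ x < 14, ρ' x = ρ x) :
    Consts n s t k B ρ' := by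
  constructor <;> rw [h' _ (by omega)]
  exacts [h.one, h.num, h.source, h.target, h.hops, h.nn, h.vert, h.edge, h.cls, h.fwd,
    h.bwd, h.base, h.rounds]

/-- The arrays occupy disjoint blocks of memory, so a write to one leaves the others intact; the
same holds for the four lemmas that follow. -/
theorem Rep.update_vert (h : Rep n adj A mem) {v : ℕ} (hv : v < n) (x : ℕ) :
    Rep n adj { A with vert := update A.vert v x } (update mem (n * n + n + 4 + v) x) := by
  constructor <;> intro i hi <;> simp only [update_apply] <;> split_ifs <;>
    first | rfl | omega | exact h.adj i hi | exact h.vert i hi | exact h.edge i hi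
          | exact h.cls i hi | exact h.fwd i hi | exact h.bwd i hi

theorem Rep.update_edge (h : Rep n adj A mem) (he : e < n * n) (x : ℕ) :
    Rep n adj { A with edge := update A.edge e x } (update mem (n * n + 2 * n + 4 + e) x) := by
  constructor <;> intro i hi <;> simp only [update_apply] <;> split_ifs <;>
    first | rfl | omega | exact h.adj i hi | exact h.vert i hi | exact h.edge i hi
          | exact h.cls i hi | exact h.fwd i hi | exact h.bwd i hi

theorem Rep.update_cls (h : Rep n adj A mem) {v : ℕ} (hv : v < n) (x : ℕ) :
    Rep n adj { A with cls := update A.cls v x }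
      (update mem (2 * (n * n) + 2 * n + 4 + v) x) := by
  constructor <;> intro i hi <;> simp only [update_apply] <;> split_ifs <;>
    first | rfl | omega | exact h.adj i hi | exact h.vert i hi | exact h.edge i hi
          | exact h.cls i hi | exact h.fwd i hi | exact h.bwd i hi

theorem Rep.update_fwd (h : Rep n adj A mem) {v : ℕ} (hv : v < n) (x : ℕ) :
    Rep n adj { A with fwd := update A.fwd v x }
      (update mem (2 * (n * n) + 3 * n + 4 + v) x) := by
  constructor <;> intro i hi <;> simp only [update_apply] <;> split_ifs <;>
    first | rfl | omega | exact h.adj i hi | exact h.vert i hi | exact h.edge i hi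
          | exact h.cls i hi | exact h.fwd i hi | exact h.bwd i hi

theorem Rep.update_bwd (h : Rep n adj A mem) {v : ℕ} (hv : v < n) (x : ℕ) :
    Rep n adj { A with bwd := update A.bwd v x }
      (update mem (2 * (n * n) + 4 * n + 4 + v) x) := by
  constructor <;> intro i hi <;> simp only [update_apply] <;> split_ifs <;>
    first | rfl | omega | exact h.adj i hi | exact h.vert i hi | exact h.edge i hi
          | exact h.cls i hi | exact h.fwd i hi | exact h.bwd i hi

/-- Counting loops whose bodies act on the memory only and keep the registers up to the counter. -/
theorem Halts.forDown_mem {S : Type*} {r b : ℕ} {p : Program} {g : ℕ → S → S}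
    {R : S → (ℕ → ℕ) → Prop} {N : ℕ} {σ : State} (hr : 1 < r) (h1 : σ.reg 1 = 1)
    (hp : ∀ j < N, ∀ a τ, (∀ x < r, τ.reg x = σ.reg x) → τ.reg r = j → R a τ.mem →
      Halts p τ b fun υ => (∀ x < r + 1, υ.reg x = τ.reg x) ∧ R (g j a) υ.mem)
    {a : S} (ha : R a σ.mem) (hN : σ.reg r = N) :
    Halts (RAM.forDown r p) σ (N * (b + 2) + 1) fun τ =>
      (∀ x < r, τ.reg x = σ.reg x) ∧ R (iterDown g N a) τ.mem := by
  refine Halts.forDown (R := fun a τ => (∀ x < r, τ.reg x = σ.reg x) ∧ R a τ.mem) (g := g)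
    (fun a τ h => (h.1 1 hr).trans h1) (fun a τ x h => ⟨fun y hy => ?_, h.2⟩)
    (fun j hj a τ h hτ => (hp j hj a τ h.1 hτ h.2).mono le_rfl fun υ hυ =>
      ⟨⟨fun x hx => (hυ.1 x (by omega)).trans (h.1 x hx), hυ.2⟩, (hυ.1 r (by omega)).trans hτ⟩)
    a σ ⟨fun _ _ => rfl, ha⟩ hN
  simp [hy.ne, h.1 y hy]

/-! #### The reachability sweeps -/

/-- Implements `Arrays.pushFwd` for `e = r₁₈`, `v = r₁₉`, `u = r₂₀`. -/
def pushFwd : Program :=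
  .seq (block (.add 21 10 20) [.load 21 21, .add 22 10 19]) (when 21 (.instr (.store 22 1)))

/-- Implements `Arrays.pushBwd` for `e = r₁₈`, `v = r₁₉`, `u = r₂₀`. -/
def pushBwd : Program :=
  .seq (block (.add 21 11 19) [.load 21 21, .add 22 11 20]) (when 21 (.instr (.store 22 1)))

/-- Implements `Arrays.mark` for `e = r₁₈`, `v = r₁₉`, `u = r₂₀`. -/
def mark : Program :=
  .seq (block (.add 21 10 20) [.load 21 21, .add 22 11 19, .load 22 22])
    (when 21 (when 22 (block (.add 23 7 20)
      [.store 23 1, .add 23 7 19, .store 23 1, .add 23 8 18, .store 23 1])))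

/-- Implements `Arrays.relax` for `e = r₁₈`. -/
def relax : Program :=
  .seq (divMod 18 2 19) (.seq
    -- With `a = cls u + 1` and `b = cls v`, register `24` becomes `1 - ((a - b) + (b - a))` in
    -- truncated subtraction, which is nonzero exactly when `a = b`.
    (block (.const 21 4) [.add 21 21 18, .load 21 21, .add 22 9 20, .load 22 22, .add 22 22 1,
      .add 23 9 19, .load 23 23, .sub 24 22 23, .sub 25 23 22, .add 24 24 25, .sub 24 1 24])
    (when 21 (when 24 (.seq pushFwd (.seq pushBwd mark)))))

/-- Implements `Arrays.sweeps`. -/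
def sweeps : Program :=
  .seq (.instr (.copy 17 5)) (forDown 17 (.seq (.instr (.copy 18 6)) (forDown 18 relax)))

/-- The registers `18`, `19`, `20` hold `e`, `e % n` and `e / n`. -/
structure EdgeRegs (n e : ℕ) (ρ : ℕ → ℕ) : Prop where
  edge : ρ 18 = e
  mod : ρ 19 = e % n
  div : ρ 20 = e / n

theorem halts_pushFwd (hσ : Consts n s t k B σ.reg) (he : e < n * n) (hE : EdgeRegs n e σ.reg)
    (hR : Rep n adj A σ.mem) :
    Halts pushFwd σ 5 fun τ =>
      (∀ x < 21, τ.reg x = σ.reg x) ∧ Rep n adj (A.pushFwd n e) τ.mem := by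
  have hu : e / n < n := Nat.div_lt_of_lt_mul he
  have hv : e % n < n := Nat.mod_lt _ (Nat.pos_of_ne_zero (by rintro rfl; simp at hu))
  refine (Halts.block (Q := fun τ => (∀ x < 21, τ.reg x = σ.reg x) ∧ τ.mem = σ.mem ∧
    τ.reg 21 = A.fwd (e / n) ∧ τ.reg 22 = 2 * (n * n) + 3 * n + 4 + e % n) _ _ σ
    ⟨fun x hx => ?_, ?_, ?_, ?_⟩).seq
    fun τ ⟨h1, h2, h3, h4⟩ => Halts.when le_rfl (fun h => Halts.block _ [] τ ?_) fun h => ?_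
  · have : ∀ r, 21 ≤ r → x ≠ r := by omega
    simp [Instr.exec, this]
  · simp [Instr.exec]
  · simp [Instr.exec, hσ.fwd, hE.div, hR.fwd _ hu]
  · simp [Instr.exec, hσ.fwd, hE.mod]
  · rw [Arrays.pushFwd, if_pos (h3 ▸ h)]
    refine ⟨fun x hx => h1 x hx, ?_⟩
    have := hR.update_fwd hv 1
    simpa [Instr.exec, h2, h4, h1 1, hσ.one] using this
  · rw [Arrays.pushFwd, if_neg (not_not.2 (h3 ▸ h))]
    exact ⟨h1, h2 ▸ hR⟩

theorem halts_pushBwd (hσ : Consts n s t k B σ.reg) (he : e < n * n) (hE : EdgeRegs n e σ.reg)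
    (hR : Rep n adj A σ.mem) :
    Halts pushBwd σ 5 fun τ =>
      (∀ x < 21, τ.reg x = σ.reg x) ∧ Rep n adj (A.pushBwd n e) τ.mem := by
  have hu : e / n < n := Nat.div_lt_of_lt_mul he
  have hv : e % n < n := Nat.mod_lt _ (Nat.pos_of_ne_zero (by rintro rfl; simp at hu))
  refine (Halts.block (Q := fun τ => (∀ x < 21, τ.reg x = σ.reg x) ∧ τ.mem = σ.mem ∧
    τ.reg 21 = A.bwd (e % n) ∧ τ.reg 22 = 2 * (n * n) + 4 * n + 4 + e / n) _ _ σ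
    ⟨fun x hx => ?_, ?_, ?_, ?_⟩).seq
    fun τ ⟨h1, h2, h3, h4⟩ => Halts.when le_rfl (fun h => Halts.block _ [] τ ?_) fun h => ?_
  · have : ∀ r, 21 ≤ r → x ≠ r := by omega
    simp [Instr.exec, this]
  · simp [Instr.exec]
  · simp [Instr.exec, hσ.bwd, hE.mod, hR.bwd _ hv]
  · simp [Instr.exec, hσ.bwd, hE.div]
  · rw [Arrays.pushBwd, if_pos (h3 ▸ h)]
    refine ⟨fun x hx => h1 x hx, ?_⟩
    have := hR.update_bwd hu 1
    simpa [Instr.exec, h2, h4, h1 1, hσ.one] using this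
  · rw [Arrays.pushBwd, if_neg (not_not.2 (h3 ▸ h))]
    exact ⟨h1, h2 ▸ hR⟩

theorem halts_mark (hσ : Consts n s t k B σ.reg) (he : e < n * n) (hE : EdgeRegs n e σ.reg)
    (hR : Rep n adj A σ.mem) :
    Halts mark σ 12 fun τ =>
      (∀ x < 21, τ.reg x = σ.reg x) ∧ Rep n adj (A.mark n e) τ.mem := by
  have hu : e / n < n := Nat.div_lt_of_lt_mul he
  have hv : e % n < n := Nat.mod_lt _ (Nat.pos_of_ne_zero (by rintro rfl; simp at hu))
  refine (Halts.block (Q := fun τ => (∀ x < 21, τ.reg x = σ.reg x) ∧ τ.mem = σ.mem ∧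
    τ.reg 21 = A.fwd (e / n) ∧ τ.reg 22 = A.bwd (e % n)) _ _ σ
    ⟨fun x hx => ?_, ?_, ?_, ?_⟩).seq
    fun τ ⟨h1, h2, h3, h4⟩ => Halts.when (b := 7) (by omega) (fun h => Halts.when (b := 6)
      (by omega) (fun h' => Halts.block _ _ τ ?_) fun h' => ?_) fun h => ?_
  · have : ∀ r, 21 ≤ r → x ≠ r := by omega
    simp [Instr.exec, this]
  · simp [Instr.exec]
  · simp [Instr.exec, hσ.fwd, hE.div, hR.fwd _ hu]
  · simp [Instr.exec, hσ.bwd, hE.mod, hR.bwd _ hv]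
  · rw [Arrays.mark, if_pos ⟨h3 ▸ h, h4 ▸ h'⟩]
    refine ⟨fun x hx => ?_, ?_⟩
    · have : ∀ r, 21 ≤ r → x ≠ r := by omega
      simp [Instr.exec, this, h1 x hx]
    have := ((hR.update_vert hu 1).update_vert hv 1).update_edge he 1
    simpa [Instr.exec, h2, h1 1, h1 7, h1 8, h1 18, h1 19, h1 20, hσ.one, hσ.vert, hσ.edge,
      hE.edge, hE.div, hE.mod] using this
  · rw [Arrays.mark, if_neg fun h'' => h''.2 (h4 ▸ h')]
    exact ⟨h1, h2 ▸ hR⟩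
  · rw [Arrays.mark, if_neg fun h'' => h''.1 (h3 ▸ h)]
    exact ⟨h1, h2 ▸ hR⟩

theorem EdgeRegs.congr (h : EdgeRegs n e ρ) (h' : ∀ x < 21, ρ' x = ρ x) : EdgeRegs n e ρ' :=
  ⟨(h' _ (by omega)).trans h.1, (h' _ (by omega)).trans h.2, (h' _ (by omega)).trans h.3⟩

/-- The quotient `e / n` is below `n`, which bounds the division by about `5 * n` steps; everything
else takes constant time. -/
theorem halts_relax (hσ : Consts n s t k B σ.reg) (he : e < n * n) (hE : σ.reg 18 = e)
    (hR : Rep n adj A σ.mem) :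
    Halts relax σ (n * 5 + 50) fun τ =>
      (∀ x < 19, τ.reg x = σ.reg x) ∧ Rep n adj (A.relax n adj e) τ.mem := by
  have hu : e / n < n := Nat.div_lt_of_lt_mul he
  have hn : 0 < n := Nat.pos_of_ne_zero (by rintro rfl; simp at hu)
  have hv : e % n < n := Nat.mod_lt _ hn
  refine ((halts_divMod (by omega) (by omega) (by omega) σ hσ.one (by rwa [hσ.num])).seq
    (b' := 36) fun τ ⟨h1, h2, h3, h4⟩ => (Halts.block (Q := fun υ => (∀ x < 21, υ.reg x = τ.reg x) ∧
      υ.mem = σ.mem ∧ υ.reg 21 = adj e ∧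
      (υ.reg 24 ≠ 0 ↔ A.cls (e % n) = A.cls (e / n) + 1)) _ _ τ ⟨fun x hx => ?_, ?_, ?_, ?_⟩).seq
      (b' := 24) fun υ ⟨k1, k2, k3, k4⟩ => Halts.when (b := 23) (by omega) (fun h =>
      Halts.when (b := 22) (by omega) (fun h' => ?_) fun h' => ?_) fun h => ?_).mono ?_ fun _ => id
  · rw [hE, hσ.num]
    simp
    omega
  · have : ∀ r, 21 ≤ r → x ≠ r := by omega
    simp [Instr.exec, this]
  · simp [Instr.exec, h1]
  · simp [Instr.exec, h1, h2 18, hE, hR.adj e he]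
  · rw [hσ.num, hE] at h3 h4
    simp only [Nat.reduceAdd] at h4
    simp [Instr.exec, h1, h2 1, h2 9, hσ.one, hσ.cls, h3, h4, hR.cls _ hu, hR.cls _ hv]
    omega
  · have hE' : EdgeRegs n e υ.reg := by
      refine ⟨?_, ?_, ?_⟩
      · rw [k1 _ (by omega), h2 _ (by omega), hE]
      · rw [k1 _ (by omega), h3, hE, hσ.num]
      · rw [k1 _ (by omega), h4, hE, hσ.num]
    have hC : Consts n s t k B υ.reg :=
      hσ.congr fun x hx => (k1 x (by omega)).trans (h2 x (by omega))
    rw [Arrays.relax, if_pos (k3 ▸ h), if_pos (k4.1 h')]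
    refine (halts_pushFwd hC he hE' (k2 ▸ hR)).seq fun τ₁ ⟨l1, m1⟩ =>
      (halts_pushBwd (hC.congr fun x hx => l1 x (by omega)) he (hE'.congr l1) m1).seq
      fun τ₂ ⟨l2, m2⟩ => (halts_mark ((hC.congr fun x hx => l1 x (by omega)).congr
        fun x hx => l2 x (by omega)) he ((hE'.congr l1).congr l2) m2).mono le_rfl ?_
    rintro τ₃ ⟨l3, m3⟩
    refine ⟨fun x hx => ?_, m3⟩
    rw [l3 x (by omega), l2 x (by omega), l1 x (by omega), k1 x (by omega), h2 x (by omega)]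
  · rw [Arrays.relax, if_pos (k3 ▸ h), if_neg fun h'' => k4.2 h'' h']
    exact ⟨fun x hx => (k1 x (by omega)).trans (h2 x (by omega)), k2 ▸ hR⟩
  · rw [Arrays.relax, if_neg (not_not.2 (k3 ▸ h))]
    exact ⟨fun x hx => (k1 x (by omega)).trans (h2 x (by omega)), k2 ▸ hR⟩

theorem halts_sweeps (hσ : Consts n s t k B σ.reg) (hR : Rep n adj A σ.mem) :
    Halts sweeps σ ((k + 1) * (n * n * (n * 5 + 52) + 4) + 2) fun τ =>
      (∀ x < 17, τ.reg x = σ.reg x) ∧ Rep n adj (A.sweeps n adj k) τ.mem := by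
  refine ((Halts.block (Q := fun τ => (∀ x < 17, τ.reg x = σ.reg x) ∧ τ.mem = σ.mem ∧
    τ.reg 17 = k + 1) (.copy 17 5) [] σ ⟨fun x hx => ?_, ?_, ?_⟩).seq
    fun τ ⟨h1, h2, h3⟩ => (Halts.forDown_mem (R := Rep n adj)
      (g := fun _ => iterDown (Arrays.relax n adj) (n * n)) (b := n * n * (n * 5 + 52) + 2)
      (by omega) ((h1 1 (by omega)).trans hσ.one)
      (fun j hj a υ k1 k2 k3 => ?_) (h2 ▸ hR) h3).mono le_rfl fun υ ⟨k1, k2⟩ =>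
      ⟨fun x hx => (k1 x hx).trans (h1 x hx), k2⟩).mono (le_of_eq (by simp; ring)) fun _ => id
  · have : ∀ r, 17 ≤ r → x ≠ r := by omega
    simp [Instr.exec, this]
  · simp [Instr.exec]
  · simp [Instr.exec, hσ.hops]
  · have hC : Consts n s t k B υ.reg :=
      hσ.congr fun x hx => (k1 x (by omega)).trans (h1 x (by omega))
    refine ((Halts.block (Q := fun τ => (∀ x < 18, τ.reg x = υ.reg x) ∧ τ.mem = υ.mem ∧
      τ.reg 18 = n * n) (.copy 18 6) [] υ ⟨fun x hx => ?_, ?_, ?_⟩).seq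
      fun τ₁ ⟨l1, l2, l3⟩ => (Halts.forDown_mem (R := Rep n adj) (g := Arrays.relax n adj)
        (b := n * 5 + 50) (by omega) ((l1 1 (by omega)).trans hC.one)
        (fun e he a τ₂ m1 m2 m3 => halts_relax (hC.congr fun x hx => (m1 x (by omega)).trans
          (l1 x (by omega))) he m2 m3) (l2 ▸ k3) l3).mono le_rfl fun τ₂ ⟨m1, m2⟩ =>
      ⟨fun x hx => (m1 x hx).trans (l1 x hx), m2⟩).mono (le_of_eq (by simp; ring)) fun _ => id
    · have : ∀ r, 18 ≤ r → x ≠ r := by omega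
      simp [Instr.exec, this]
    · simp [Instr.exec]
    · simp [Instr.exec, hC.nn]

end RAM

namespace RAM

open Function

variable {n s t k B : ℕ} {adj : ℕ → ℕ} {A : Arrays} {σ : State}

/-! #### One round -/

/-- Implements `Arrays.reset`. -/
def reset : Program :=
  .seq (.instr (.copy 17 2)) (.seq
    (forDown 17 (block (.const 18 0) [.add 19 10 17, .store 19 18, .add 19 11 17, .store 19 18]))
    (block (.add 18 10 3) [.store 18 1, .add 18 11 4, .store 18 1]))

/-- Implements `Arrays.assignOne` for `p = r₁₅`, `i = r₁₇`, `c = r₁₈`, `v = r₁₉`. -/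
def assignOne : Program :=
  .seq (divMod 19 15 20) (.seq
    (block (.sub 21 20 18) [.sub 22 18 20, .add 21 21 22, .sub 21 1 21])
    (when 21 (block (.add 22 9 19) [.store 22 17])))

/-- Implements `Arrays.decode` for `p = r₁₅`, `i = r₁₇`; the number to be decoded is `r₁₆`. -/
def decode : Program :=
  .seq (divMod 16 12 18) (.seq (block (.copy 16 19) [.copy 19 2]) (forDown 19 assignOne))

/-- Implements `Arrays.round` for `w = r₁₄`. -/
def round : Program :=
  .seq (divMod 14 12 15) (.seq (block (.add 15 15 1) [.copy 17 5]) (.seq (forDown 17 decode)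
    (.seq reset sweeps)))

theorem halts_reset (hσ : Consts n s t k B σ.reg) (hs : s < n) (ht : t < n)
    (hR : Rep n adj A σ.mem) :
    Halts reset σ (n * 7 + 6) fun τ =>
      (∀ x < 17, τ.reg x = σ.reg x) ∧ Rep n adj (A.reset n s t) τ.mem := by
  refine ((Halts.block (Q := fun τ => (∀ x < 17, τ.reg x = σ.reg x) ∧ τ.mem = σ.mem ∧
    τ.reg 17 = n) (.copy 17 2) [] σ ⟨fun x hx => ?_, ?_, ?_⟩).seq
    fun τ ⟨h1, h2, h3⟩ => (Halts.forDown_mem (R := Rep n adj)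
      (g := Arrays.clear) (b := 5)
      (by omega) ((h1 1 (by omega)).trans hσ.one)
      (fun j hj a υ k1 k2 k3 => Halts.block _ _ υ ?_) (h2 ▸ hR) h3).seq
      fun υ ⟨k1, k2⟩ => Halts.block _ _ υ ?_).mono (by simp; omega) fun _ => id
  · have : ∀ r, 17 ≤ r → x ≠ r := by omega
    simp [Instr.exec, this]
  · simp [Instr.exec]
  · simp [Instr.exec, hσ.num]
  · refine ⟨fun x hx => ?_, ?_⟩
    · have : ∀ r, 18 ≤ r → x ≠ r := by omega
      simp [Instr.exec, this]
    · have := (k3.update_fwd hj 0).update_bwd hj 0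
      simpa [Instr.exec, Arrays.clear, k1 10, k1 11, h1 10, h1 11, hσ.fwd, hσ.bwd, k2] using this
  · refine ⟨fun x hx => ?_, ?_⟩
    · have : ∀ r, 17 ≤ r → x ≠ r := by omega
      simp [Instr.exec, this, k1 x hx, h1 x hx]
    · have := (k2.update_fwd hs 1).update_bwd ht 1
      simpa [Instr.exec, Arrays.reset, k1 1, k1 3, k1 4, k1 10, k1 11, h1 1, h1 3, h1 4, h1 10, h1 11,
        hσ.one, hσ.source, hσ.target, hσ.fwd, hσ.bwd] using this

theorem halts_assignOne (hσ : Consts n s t k B σ.reg) {v : ℕ} (hv : v < n) (hv' : σ.reg 19 = v)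
    (hp : 0 < σ.reg 15) (hR : Rep n adj A σ.mem) :
    Halts assignOne σ (n * 5 + 12) fun τ => (∀ x < 20, τ.reg x = σ.reg x) ∧
      Rep n adj (A.assignOne (σ.reg 15) (σ.reg 18) (σ.reg 17) v) τ.mem := by
  refine ((halts_divMod (by omega) (by omega) (by omega) σ hσ.one hp).seq
    (b' := 7) fun τ ⟨h1, h2, h3, h4⟩ => (Halts.block (Q := fun υ => (∀ x < 20, υ.reg x = σ.reg x) ∧
      υ.mem = σ.mem ∧ (υ.reg 21 ≠ 0 ↔ v % σ.reg 15 = σ.reg 18)) _ _ τ ⟨fun x hx => ?_, ?_, ?_⟩).seq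
      (b' := 3) fun υ ⟨k1, k2, k3⟩ => Halts.when (b := 2) (by omega)
      (fun h => Halts.block _ _ υ ?_) fun h => ?_).mono ?_ fun _ => id
  · have : σ.reg 19 / σ.reg 15 ≤ σ.reg 19 := Nat.div_le_self _ _
    simp
    omega
  · have : ∀ r, 20 ≤ r → x ≠ r := by omega
    simp [Instr.exec, this, h2 x hx]
  · simp [Instr.exec, h1]
  · rw [hv'] at h3
    simp [Instr.exec, h2 1, h2 18, hσ.one, h3]
    omega
  · rw [Arrays.assignOne, if_pos (k3.1 h)]
    refine ⟨fun x hx => ?_, ?_⟩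
    · have : ∀ r, 20 ≤ r → x ≠ r := by omega
      simp [Instr.exec, this, k1 x hx]
    · have := hR.update_cls hv (σ.reg 17)
      simpa [Instr.exec, k1 9, k1 17, k1 19, hv', hσ.cls, k2] using this
  · rw [Arrays.assignOne, if_neg fun h' => k3.2 h' h]
    exact ⟨k1, k2 ▸ hR⟩

theorem halts_decode (hσ : Consts n s t k B σ.reg) (hB : 0 < B) (hp : 0 < σ.reg 15)
    {z : ℕ × Arrays} (hz : σ.reg 16 = z.1) (hR : Rep n adj z.2 σ.mem) :
    Halts decode σ (z.1 * 5 + n * (n * 5 + 14) + 8) fun τ =>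
      (∀ x < 16, τ.reg x = σ.reg x) ∧ τ.reg 17 = σ.reg 17 ∧
      τ.reg 16 = (Arrays.decode n B (σ.reg 15) (σ.reg 17) z).1 ∧
      Rep n adj (Arrays.decode n B (σ.reg 15) (σ.reg 17) z).2 τ.mem := by
  refine ((halts_divMod (by omega) (by omega) (by omega) σ hσ.one (by rwa [hσ.base])).seq
    (b' := n * (n * 5 + 14) + 3) fun τ ⟨h1, h2, h3, h4⟩ =>
      ((Halts.block (Q := fun υ => (∀ x < 16, υ.reg x = σ.reg x) ∧ υ.reg 17 = σ.reg 17 ∧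
        υ.reg 16 = z.1 / B ∧ υ.reg 18 = z.1 % B ∧ υ.reg 19 = n ∧ υ.mem = σ.mem) _ _ τ
        ⟨fun x hx => ?_, ?_, ?_, ?_, ?_, ?_⟩).seq
      fun υ ⟨k1, k2, k3, k4, k5, k6⟩ => (Halts.forDown_mem (R := Rep n adj)
        (g := Arrays.assignOne (σ.reg 15) (z.1 % B) (σ.reg 17)) (b := n * 5 + 12) (by omega)
        ((k1 1 (by omega)).trans hσ.one) (fun j hj a υ' l1 l2 l3 => ?_) (k6 ▸ hR) k5).mono le_rfl
        ?_).mono ?_ fun _ => id).mono ?_ fun _ => id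
  · rw [hz, hσ.base]
    have : z.1 / B ≤ z.1 := Nat.div_le_self _ _
    omega
  · have : ∀ r, 16 ≤ r → x ≠ r := by omega
    simp [Instr.exec, this, h2 x (by omega)]
  · simp [Instr.exec, h2 17]
  · simpa [Instr.exec, hz, hσ.base] using h4
  · simp [Instr.exec, h3, hz, hσ.base]
  · simp [Instr.exec, h2 2, hσ.num]
  · simp [Instr.exec, h1]
  · have hC : Consts n s t k B υ'.reg :=
      hσ.congr fun x hx => (l1 x (by omega)).trans (k1 x (by omega))
    have h15 : υ'.reg 15 = σ.reg 15 := (l1 15 (by omega)).trans (k1 15 (by omega))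
    have h17 : υ'.reg 17 = σ.reg 17 := (l1 17 (by omega)).trans k2
    have h18 : υ'.reg 18 = z.1 % B := (l1 18 (by omega)).trans k4
    have := halts_assignOne hC hj l2 (by rwa [h15]) l3
    rwa [h15, h17, h18] at this
  · rintro υ' ⟨l1, l2⟩
    exact ⟨fun x hx => (l1 x (by omega)).trans (k1 x hx), (l1 17 (by omega)).trans k2,
      (l1 16 (by omega)).trans k3, l2⟩
  · exact le_of_eq (by simp; ring)

/-- A bound for the number of steps of one round, where `w` is the number of rounds. -/
def roundCost (n k w : ℕ) : ℕ :=
  w * 5 + 7 + ((k + 1) * (w * 5 + n * (n * 5 + 14) + 10) + 1) + (n * 7 + 6) +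
    ((k + 1) * (n * n * (n * 5 + 52) + 4) + 2)

theorem halts_round (hσ : Consts n s t k B σ.reg) (hB : 0 < B) (hs : s < n) (ht : t < n)
    {w W : ℕ} (hw : w ≤ W) (h14 : σ.reg 14 = w) (hR : Rep n adj A σ.mem) :
    Halts round σ (roundCost n k W) fun τ =>
      (∀ x < 15, τ.reg x = σ.reg x) ∧ Rep n adj (A.round n s t k B adj w) τ.mem := by
  have hdiv : w / B ≤ w := Nat.div_le_self _ _
  refine ((halts_divMod (by omega) (by omega) (by omega) σ hσ.one (by rwa [hσ.base])).seq
    (b' := 2 + ((k + 1) * (w * 5 + n * (n * 5 + 14) + 10) + 1 + (n * 7 + 6 +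
      ((k + 1) * (n * n * (n * 5 + 52) + 4) + 2)))) fun τ ⟨h1, h2, h3, h4⟩ =>
      (Halts.block (Q := fun υ => (∀ x < 15, υ.reg x = σ.reg x) ∧ υ.reg 15 = w % B + 1 ∧
        υ.reg 16 = w / B ∧ υ.reg 17 = k + 1 ∧ υ.mem = σ.mem) _ _ τ
        ⟨fun x hx => ?_, ?_, ?_, ?_, ?_⟩).seq
      fun υ ⟨k1, k2, k3, k4, k5⟩ => (Halts.forDown (b := w * 5 + n * (n * 5 + 14) + 8)
        (g := Arrays.decode n B (w % B + 1))
        -- Decoding never increases the number, so `z.1 ≤ w` bounds the cost of every division in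
        -- the loop.
        (R := fun z υ' => (∀ x < 16, υ'.reg x = υ.reg x) ∧ υ'.reg 16 = z.1 ∧ z.1 ≤ w ∧
          Rep n adj z.2 υ'.mem) (fun a υ' l => (l.1 1 (by omega)).trans
            ((k1 1 (by omega)).trans hσ.one)) (fun a υ' y ⟨l1, l2, l3, l4⟩ =>
            ⟨fun x hx => ?_, ?_, l3, l4⟩) (fun j hj z υ' ⟨l1, l2, l3, l4⟩ l5 => ?_) (w / B, A) υ
            ⟨fun _ _ => rfl, k3, hdiv, k5 ▸ hR⟩ k4).seq ?_).mono ?_ fun _ => id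
  · rw [h14, hσ.base]
    have h5 : (k + 1) * (w * 5 + n * (n * 5 + 14) + 10) ≤
      (k + 1) * (W * 5 + n * (n * 5 + 14) + 10) := Nat.mul_le_mul_left _ (by omega)
    unfold roundCost
    omega
  · have : ∀ r, 15 ≤ r → x ≠ r := by omega
    simp [Instr.exec, this, h2 x hx]
  · simp [Instr.exec, h2 1, hσ.one, h3, h14, hσ.base]
  · simpa [Instr.exec, h14, hσ.base] using h4
  · simp [Instr.exec, h2 5, hσ.hops]
  · simp [Instr.exec, h1]
  · simp [show x ≠ 17 by omega, l1 x hx]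
  · simpa using l2
  · have hC : Consts n s t k B υ'.reg :=
      hσ.congr fun x hx => (l1 x (by omega)).trans (k1 x (by omega))
    have h15 : υ'.reg 15 = w % B + 1 := (l1 15 (by omega)).trans k2
    have := halts_decode hC hB (by omega) l2 l4
    rw [h15, l5] at this
    refine this.mono (by omega) fun τ' ⟨m1, m2, m3, m4⟩ => ⟨⟨fun x hx =>
      (m1 x hx).trans (l1 x hx), m3, (Nat.div_le_self _ _).trans l3, m4⟩, m2⟩
  · rintro υ' ⟨l1, -, -, l4⟩
    have hC : Consts n s t k B υ'.reg :=
      hσ.congr fun x hx => (l1 x (by omega)).trans (k1 x (by omega))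
    refine (halts_reset hC hs ht l4).seq fun υ₁ ⟨m1, m2⟩ =>
      (halts_sweeps (hC.congr fun x hx => m1 x (by omega)) m2).mono le_rfl ?_
    rintro υ₂ ⟨m3, m4⟩
    refine ⟨fun x hx => ?_, m4⟩
    rw [m3 x (by omega), m1 x (by omega), l1 x (by omega), k1 x hx]

/-! #### All rounds, and the output -/

/-- All rounds of the algorithm. -/
def rounds : Program := .seq (.instr (.copy 14 13)) (forDown 14 round)

/-- Copy the output to the front of the memory. -/
def output : Program :=
  .seq (block (.add 14 6 2) []) (.seq
    (forDown 14 (block (.add 16 7 14) [.load 16 16, .store 14 16])) (.instr (.add 0 6 2)))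

theorem halts_rounds (hσ : Consts n s t k B σ.reg) (hB : 0 < B) (hs : s < n) (ht : t < n)
    (hR : Rep n adj Arrays.zero σ.mem) :
    Halts rounds σ (B ^ (k + 2) * (roundCost n k (B ^ (k + 2)) + 2) + 2) fun τ =>
      (∀ x < 14, τ.reg x = σ.reg x) ∧ Rep n adj (Arrays.final n s t k B adj) τ.mem := by
  refine ((Halts.block (Q := fun τ => (∀ x < 14, τ.reg x = σ.reg x) ∧ τ.mem = σ.mem ∧
    τ.reg 14 = B ^ (k + 2)) (.copy 14 13) [] σ ⟨fun x hx => ?_, ?_, ?_⟩).seq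
    fun τ ⟨h1, h2, h3⟩ => (Halts.forDown_mem (R := Rep n adj)
      (g := Arrays.round n s t k B adj) (b := roundCost n k (B ^ (k + 2)))
      (by omega) ((h1 1 (by omega)).trans hσ.one)
      (fun j hj a υ k1 k2 k3 => halts_round (hσ.congr fun x hx => (k1 x hx).trans (h1 x hx)) hB hs
        ht hj.le k2 k3) (h2 ▸ hR) h3).mono le_rfl fun υ ⟨k1, k2⟩ =>
      ⟨fun x hx => (k1 x hx).trans (h1 x hx), k2⟩).mono (le_of_eq (by simp; ring)) fun _ => id
  · simp [Instr.exec, hx.ne]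
  · simp [Instr.exec]
  · simp [Instr.exec, hσ.rounds]

/-- By `hN` the source lies beyond the target, so no cell is overwritten before it is read. The
vertex and edge blocks are adjacent, so one such loop moves the whole output. -/
theorem iterDown_copy {c N : ℕ} (hN : N ≤ c) (mem : ℕ → ℕ) (i : ℕ) :
    iterDown (fun j m => update m j (m (c + j))) N mem i =
      if i < N then mem (c + i) else mem i := by
  induction N generalizing mem with
  | zero => simp [iterDown]
  | succ N ih =>
    rw [iterDown, ih (by omega)]
    simp only [update_apply]
    split_ifs <;> first | rfl | omega | (congr 1; omega)

theorem halts_output (hσ : Consts n s t k B σ.reg) (hR : Rep n adj A σ.mem) :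
    Halts output σ ((n * n + n) * 5 + 3) fun τ => τ.reg 0 = n * n + n ∧
      (∀ v < n, τ.mem v = A.vert v) ∧ ∀ e < n * n, τ.mem (n + e) = A.edge e := by
  refine ((Halts.block (Q := fun τ => (∀ x < 14, τ.reg x = σ.reg x) ∧ τ.mem = σ.mem ∧
    τ.reg 14 = n * n + n) (.add 14 6 2) [] σ ⟨fun x hx => ?_, ?_, ?_⟩).seq
    fun τ ⟨h1, h2, h3⟩ => (Halts.forDown_mem (R := fun m m' => m' = m)
      (g := fun j m => update m j (m (n * n + n + 4 + j))) (b := 3)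
      (by omega) ((h1 1 (by omega)).trans hσ.one)
      (fun j hj a υ k1 k2 k3 => Halts.block _ _ υ ?_) rfl h3).seq
      fun υ ⟨k1, k2⟩ => Halts.block _ [] υ ?_).mono (by simp; omega) fun _ => id
  · simp [Instr.exec, hx.ne]
  · simp [Instr.exec]
  · simp [Instr.exec, hσ.num, hσ.nn]
  · subst k3
    refine ⟨fun x hx => ?_, ?_⟩
    · have : ∀ r, 15 ≤ r → x ≠ r := by omega
      simp [Instr.exec, this]
    · simp [Instr.exec, k1 7, h1 7, hσ.vert, k2]
  · refine ⟨?_, fun v hv => ?_, fun e he => ?_⟩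
    · simp [Instr.exec, k1 6, h1 6, k1 2, h1 2, hσ.num, hσ.nn]
    · simp only [List.foldl_nil, Instr.exec, k2, iterDown_copy (Nat.le_add_right (n * n + n) 4)]
      rw [if_pos (by omega), h2, hR.vert v hv]
    · simp only [List.foldl_nil, Instr.exec, k2, iterDown_copy (Nat.le_add_right (n * n + n) 4)]
      rw [if_pos (by omega), h2, ← hR.edge e he]
      congr 1; omega

end RAM

namespace RAM

open Function

/-! #### Initialization -/

/-- `r₁₄ := ⌈log₂ r₂⌉`. -/
def log : Program :=
  .seq (block (.const 14 0) [.const 15 1, .sub 16 2 15])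
    (.loop 16 (block (.add 15 15 15) [.add 14 14 1, .sub 16 2 15]))

theorem halts_log {n : ℕ} (hn : 0 < n) (σ : State) (h1 : σ.reg 1 = 1) (h2 : σ.reg 2 = n) :
    Halts log σ (n * 4 + 4) fun τ => τ.mem = σ.mem ∧ (∀ x < 14, τ.reg x = σ.reg x) ∧
      n ≤ 2 ^ τ.reg 14 ∧ 2 ^ τ.reg 14 ≤ 2 * n := by
  -- Induction on the gap `d = n - 2 ^ L`, which shrinks with each doubling. The body runs only
  -- while `2 ^ L < n`, which preserves `2 ^ L ≤ 2 * n`.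
  have key : ∀ d L (τ : State), d = n - 2 ^ L → τ.mem = σ.mem → (∀ x < 14, τ.reg x = σ.reg x) →
      τ.reg 14 = L → τ.reg 15 = 2 ^ L → τ.reg 16 = d → 2 ^ L ≤ 2 * n →
      Halts (.loop 16 (block (.add 15 15 15) [.add 14 14 1, .sub 16 2 15])) τ (d * 4 + 1) fun τ =>
        τ.mem = σ.mem ∧ (∀ x < 14, τ.reg x = σ.reg x) ∧
        n ≤ 2 ^ τ.reg 14 ∧ 2 ^ τ.reg 14 ≤ 2 * n := by
    intro d
    induction d using Nat.strong_induction_on with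
    | _ d ih =>
    intro L τ hd t1 t2 t3 t4 t5 t6
    have hpos : 0 < 2 ^ L := by positivity
    by_cases h : d = 0
    · exact ⟨1, τ, .loop_zero (by omega), by omega, t1, t2, by rw [t3]; omega, by rwa [t3]⟩
    · obtain ⟨T, υ, e1, e2, e3, e4, e5, e6, e7⟩ := Halts.block (Q := fun υ => υ.mem = σ.mem ∧
        (∀ x < 14, υ.reg x = σ.reg x) ∧ υ.reg 14 = L + 1 ∧ υ.reg 15 = 2 ^ (L + 1) ∧
        υ.reg 16 = n - 2 ^ (L + 1)) (.add 15 15 15) [.add 14 14 1, .sub 16 2 15] τ (by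
          refine ⟨by simp [Instr.exec, t1], fun x hx => ?_, ?_⟩
          · have : ∀ r, 14 ≤ r → x ≠ r := by omega
            simp [Instr.exec, this, t2 x hx]
          · simp [Instr.exec, t2 1, t2 2, h1, h2, t3, t4]
            omega)
      obtain ⟨T', υ', f1, f2, f3⟩ := ih (n - 2 ^ (L + 1)) (by omega) (L + 1) υ rfl e3 e4 e5 e6 e7
        (by omega)
      refine ⟨T + T' + 1, υ', .loop_pos (by omega) e1 f1, ?_, f3⟩
      simp at e2
      omega
  refine ((Halts.block (Q := fun υ => υ.mem = σ.mem ∧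
        (∀ x < 14, υ.reg x = σ.reg x) ∧ υ.reg 14 = 0 ∧ υ.reg 15 = 1 ∧
        υ.reg 16 = n - 1) _ _ σ ?_).seq fun τ ⟨t1, t2, t3, t4, t5⟩ =>
        key (n - 1) 0 τ (by simp) t1 t2 t3 (by simpa using t4) t5 (by omega)).mono
        (by simp; omega) fun _ => id
  refine ⟨by simp [Instr.exec], fun x hx => ?_, ?_⟩
  · have : ∀ r, 14 ≤ r → x ≠ r := by omega
    simp [Instr.exec, this]
  · simp [Instr.exec, h2]

/-- `r₁₃ := r₁₂ ^ (r₅ + 1)`. -/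
def pow : Program :=
  .seq (block (.const 13 1) [.add 14 5 1])
    (forDown 14 (.seq (mul 13 12 15) (.instr (.copy 13 15))))

theorem iterDown_mul (c N a : ℕ) : iterDown (fun _ x => x * c) N a = a * c ^ N := by
  induction N generalizing a with
  | zero => simp [iterDown]
  | succ N ih => rw [iterDown, ih]; ring

theorem halts_pow (σ : State) (h1 : σ.reg 1 = 1) :
    Halts pow σ ((σ.reg 5 + 1) * (σ.reg 12 * 3 + 6) + 3) fun τ => τ.mem = σ.mem ∧
      (∀ x < 13, τ.reg x = σ.reg x) ∧ τ.reg 13 = σ.reg 12 ^ (σ.reg 5 + 1) := by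
  refine ((Halts.block (Q := fun τ => (τ.mem = σ.mem ∧ (∀ x < 13, τ.reg x = σ.reg x) ∧
    τ.reg 13 = 1) ∧ τ.reg 14 = σ.reg 5 + 1) _ _ σ ?_).seq fun τ hτ =>
    Halts.forDown (g := fun _ x => x * σ.reg 12) (b := σ.reg 12 * 3 + 4)
      (R := fun c τ => τ.mem = σ.mem ∧ (∀ x < 13, τ.reg x = σ.reg x) ∧ τ.reg 13 = c)
      ?_ ?_ ?_ 1 τ hτ.1 hτ.2).mono (le_of_eq (by simp; ring)) ?_
  · refine ⟨⟨by simp [Instr.exec], fun x hx => ?_, ?_⟩, ?_⟩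
    · have : ∀ r, 13 ≤ r → x ≠ r := by omega
      simp [Instr.exec, this]
    · simp [Instr.exec]
    · simp [Instr.exec, h1]
  · rintro c τ ⟨_, h, _⟩
    rw [h 1 (by omega), h1]
  · rintro c τ x ⟨h2, h3, h4⟩
    refine ⟨h2, fun y hy => ?_, ?_⟩
    · simp [show y ≠ 14 by omega, h3 y hy]
    · simp [h4]
  · rintro j - c τ ⟨h2, h3, h4⟩ h5
    refine ((halts_mul (by omega) (by omega) (by omega) τ ((h3 1 (by omega)).trans h1)).seq
      fun υ ⟨k1, k2, k3⟩ => Halts.block (.copy 13 15) [] υ ?_).mono ?_ fun _ => id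
    · rw [h3 12 (by omega)]
      simp
    · refine ⟨⟨by simp [Instr.exec, k1, h2], fun x hx => ?_, ?_⟩, ?_⟩
      · simp [Instr.exec, hx.ne, k2 x (by omega), h3 x hx]
      · simp [Instr.exec, k3, h4, h3 12]
      · simp [Instr.exec, k2 14, h5]
  · rintro τ ⟨h2, h3, h4⟩
    refine ⟨h2, h3, ?_⟩
    rw [h4, iterDown_mul, one_mul]

/-- Set up the registers `1, …, 13`. -/
def init : Program :=
  .seq (block (.const 1 1) [.const 14 0, .load 2 14, .add 14 14 1, .load 3 14, .add 14 14 1,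
    .load 4 14, .add 14 14 1, .load 5 14, .add 5 5 1]) (.seq (mul 2 2 6) (.seq
  (block (.const 14 4) [.add 7 6 2, .add 7 7 14, .add 8 7 2, .add 9 8 6, .add 10 9 2,
    .add 11 10 2]) (.seq log (.seq (mul 5 5 15) (.seq (mul 14 15 16) (.seq
  -- Register `16` holds `L * (k + 1)²`; adding `4` and doubling gives `Arrays.base L k`. Register
  -- `5` holds `k + 1`, so `pow` uses the exponent `k + 2`.
  (block (.const 17 4) [.add 16 16 17, .add 12 16 16]) pow))))))

/-- A bound for the number of steps of `init`. -/
def initCost (n k B : ℕ) : ℕ :=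
  n * 7 + 43 + (k + 1) * 3 + (k + 1) * (k + 1) * 3 + (k + 2) * (B * 3 + 6)

theorem halts_init {n s t k : ℕ} (hn : 0 < n) (σ : State) (h0 : σ.mem 0 = n) (h1 : σ.mem 1 = s)
    (h2 : σ.mem 2 = t) (h3 : σ.mem 3 = k) :
    ∃ L, n ≤ 2 ^ L ∧ 2 ^ L ≤ 2 * n ∧ Halts init σ (initCost n k (Arrays.base L k)) fun τ =>
      τ.mem = σ.mem ∧ Consts n s t k (Arrays.base L k) τ.reg := by
  obtain ⟨T₁, σ₁, r₁, c₁, m₁, o₁, n₁, s₁, t₁, k₁⟩ := Halts.block (Q := fun τ => τ.mem = σ.mem ∧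
    τ.reg 1 = 1 ∧ τ.reg 2 = n ∧ τ.reg 3 = s ∧ τ.reg 4 = t ∧ τ.reg 5 = k + 1) (.const 1 1)
    [.const 14 0, .load 2 14, .add 14 14 1, .load 3 14, .add 14 14 1,
    .load 4 14, .add 14 14 1, .load 5 14, .add 5 5 1] σ (by simp [Instr.exec, h0, h1, h2, h3])
  obtain ⟨T₂, σ₂, r₂, c₂, m₂, f₂, e₂⟩ := halts_mul (a := 2) (b := 2) (m := 6) (by omega)
    (by omega) (by omega) σ₁ o₁
  have g₂ := f₂ 2 (by omega)
  obtain ⟨T₃, σ₃, r₃, c₃, m₃, f₃, e₃⟩ := Halts.block (Q := fun τ => τ.mem = σ₂.mem ∧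
    (∀ x < 7, τ.reg x = σ₂.reg x) ∧ τ.reg 7 = n * n + n + 4 ∧ τ.reg 8 = n * n + 2 * n + 4 ∧
    τ.reg 9 = 2 * (n * n) + 2 * n + 4 ∧ τ.reg 10 = 2 * (n * n) + 3 * n + 4 ∧
    τ.reg 11 = 2 * (n * n) + 4 * n + 4) (.const 14 4) [.add 7 6 2, .add 7 7 14, .add 8 7 2,
      .add 9 8 6, .add 10 9 2, .add 11 10 2] σ₂ (by
    refine ⟨by simp [Instr.exec], fun x hx => ?_, ?_⟩
    · have : ∀ r, 7 ≤ r → x ≠ r := by omega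
      simp [Instr.exec, this]
    · simp [Instr.exec, e₂, g₂, n₁]
      omega)
  have g₃ : σ₃.reg 1 = 1 ∧ σ₃.reg 2 = n ∧ σ₃.reg 5 = k + 1 :=
    ⟨by rw [f₃ _ (by omega), f₂ _ (by omega), o₁], by rw [f₃ _ (by omega), f₂ _ (by omega), n₁],
      by rw [f₃ _ (by omega), f₂ _ (by omega), k₁]⟩
  obtain ⟨T₄, σ₄, r₄, c₄, m₄, f₄, e₄⟩ := halts_log hn σ₃ g₃.1 g₃.2.1
  have g₄ : σ₄.reg 1 = 1 ∧ σ₄.reg 5 = k + 1 :=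
    ⟨by rw [f₄ _ (by omega), g₃.1], by rw [f₄ _ (by omega), g₃.2.2]⟩
  obtain ⟨T₅, σ₅, r₅, c₅, m₅, f₅, e₅⟩ := halts_mul (a := 5) (b := 5) (m := 15) (by omega)
    (by omega) (by omega) σ₄ g₄.1
  obtain ⟨T₆, σ₆, r₆, c₆, m₆, f₆, e₆⟩ := halts_mul (a := 14) (b := 15) (m := 16) (by omega)
    (by omega) (by omega) σ₅ (by rw [f₅ _ (by omega), g₄.1])
  rw [f₅ 14 (by omega), e₅, g₄.2] at e₆
  set L := σ₄.reg 14
  obtain ⟨T₇, σ₇, r₇, c₇, m₇, f₇, e₇⟩ := Halts.block (Q := fun τ => τ.mem = σ₆.mem ∧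
    (∀ x < 12, τ.reg x = σ₆.reg x) ∧ τ.reg 12 = Arrays.base L k) (.const 17 4)
    [.add 16 16 17, .add 12 16 16] σ₆ (by
    refine ⟨by simp [Instr.exec], fun x hx => ?_, ?_⟩
    · have : ∀ r, 12 ≤ r → x ≠ r := by omega
      simp [Instr.exec, this]
    · simp [Instr.exec, e₆, Arrays.base]
      omega)
  have F₇ : ∀ x < 12, σ₇.reg x = σ₃.reg x := fun x hx => by
    rw [f₇ x hx, f₆ x (by omega), f₅ x (by omega), f₄ x (by omega)]
  obtain ⟨T₈, σ₈, r₈, c₈, m₈, f₈, e₈⟩ := halts_pow σ₇ (by rw [F₇ _ (by omega), g₃.1])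
  have h57 : σ₇.reg 5 = k + 1 := by rw [F₇ _ (by omega), g₃.2.2]
  have F₈ : ∀ x < 12, σ₈.reg x = σ₃.reg x := fun x hx => by rw [f₈ x (by omega), F₇ x hx]
  refine ⟨L, e₄.1, e₄.2, _, σ₈, r₁.seq (r₂.seq (r₃.seq (r₄.seq (r₅.seq (r₆.seq (r₇.seq r₈)))))),
    ?_, ?_, ⟨?_, ?_, ?_, ?_, ?_, ?_, ?_, ?_, ?_, ?_, ?_, ?_, ?_⟩⟩
  · rw [n₁] at c₂
    rw [g₄.2] at c₅
    rw [e₅, g₄.2] at c₆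
    rw [h57, e₇] at c₈
    simp only [List.length_cons, List.length_nil] at c₁ c₃ c₇
    unfold initCost
    rw [show k + 1 + 1 = k + 2 from rfl] at c₈
    omega
  · rw [m₈, m₇, m₆, m₅, m₄, m₃, m₂, m₁]
  · rw [F₈ _ (by omega), g₃.1]
  · rw [F₈ _ (by omega), g₃.2.1]
  · rw [F₈ _ (by omega), f₃ _ (by omega), f₂ _ (by omega), s₁]
  · rw [F₈ _ (by omega), f₃ _ (by omega), f₂ _ (by omega), t₁]
  · rw [F₈ _ (by omega), g₃.2.2]
  · rw [F₈ _ (by omega), f₃ _ (by omega), e₂, n₁]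
  · rw [F₈ _ (by omega), e₃.1]
  · rw [F₈ _ (by omega), e₃.2.1]
  · rw [F₈ _ (by omega), e₃.2.2.1]
  · rw [F₈ _ (by omega), e₃.2.2.2.1]
  · rw [F₈ _ (by omega), e₃.2.2.2.2]
  · rw [f₈ _ (by omega), e₇]
  · rw [e₈, h57, e₇]

/-- The whole program. -/
def spg : Program := .seq init (.seq rounds output)

end RAM

/-! ### Input and output words -/

theorem edgeBits_eq_ofFn {n : ℕ} (E : Set (Fin n × Fin n)) :
    edgeBits E = List.ofFn fun e : Fin (n * n) => propBit ((e.divNat, e.modNat) ∈ E) := by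
  rw [List.ofFn_mul, List.ofFn_eq_map, edgeBits, List.flatMap_def]
  congr 2
  funext u
  rw [List.ofFn_eq_map]
  congr 1
  funext v
  obtain ⟨h1, h2⟩ := Arrays.mul_add_div_mod u v
  congr! 3
  · exact Fin.ext h1.symm
  · exact Fin.ext h2.symm

theorem length_edgeBits {n : ℕ} (E : Set (Fin n × Fin n)) : (edgeBits E).length = n * n := by
  rw [edgeBits_eq_ofFn, List.length_ofFn]

theorem length_vertexBits {n : ℕ} (S : Set (Fin n)) : (vertexBits S).length = n := by
  simp [vertexBits]

theorem edgeBits_getElem {n : ℕ} (E : Set (Fin n × Fin n)) {e : ℕ} (he : e < n * n) {u v : Fin n}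
    (hu : e / n = u) (hv : e % n = v) :
    (edgeBits E)[e]'(by rwa [length_edgeBits]) = propBit ((u, v) ∈ E) := by
  simp only [edgeBits_eq_ofFn, List.getElem_ofFn]
  congr! 3
  · exact Fin.ext hu
  · exact Fin.ext hv

theorem length_le_wordSize (l : List ℕ) : l.length ≤ wordSize l := by
  induction l with
  | nil => simp
  | cons a l ih =>
    simp only [wordSize, List.map_cons, List.sum_cons, List.length_cons] at ih ⊢
    omega

/-! ### The number of steps -/

/-- With `a` about `log₂ n`, this trades `(log n) ^ g` for `g ^ g` times a multiple of `n`, which is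
what makes the number of rounds admissible. It follows from `a ≤ g * 2 ^ (a / g)` by taking `g`-th
powers. -/
theorem Nat.pow_le_pow_mul_two_pow (a : ℕ) {g : ℕ} (hg : 0 < g) : a ^ g ≤ g ^ g * 2 ^ a := by
  have h1 : a ≤ g * 2 ^ (a / g) := by
    have h2 : a < g * (a / g + 1) := by
      have := Nat.div_add_mod a g
      have := Nat.mod_lt a hg
      rw [Nat.mul_succ]
      omega
    exact h2.le.trans (Nat.mul_le_mul_left g (Nat.succ_le_of_lt Nat.lt_two_pow_self))
  calc a ^ g ≤ (g * 2 ^ (a / g)) ^ g := Nat.pow_le_pow_left h1 g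
    _ = g ^ g * 2 ^ (a / g * g) := by rw [mul_pow, ← pow_mul]
    _ ≤ g ^ g * 2 ^ a :=
      Nat.mul_le_mul_left _ (Nat.pow_le_pow_right two_pos (Nat.div_mul_le_self a g))

namespace RAM

/-- The dependence of the number of steps on the parameter. -/
def paramCost (k : ℕ) : ℕ :=
  1200 * (k + 2) ^ 2 * (8 * (k + 2) ^ 2) ^ (2 * k + 4) * (2 * k + 4) ^ (2 * k + 4)

theorem computable_paramCost : Computable paramCost := by
  have hpow : Primrec₂ fun a b : ℕ => a ^ b := Primrec₂.unpaired'.1 Nat.Primrec.pow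
  have h2 : Primrec fun k : ℕ => k + 2 := Primrec.nat_add.comp .id (.const 2)
  have h3 : Primrec fun k : ℕ => (k + 2) ^ 2 := hpow.comp h2 (.const 2)
  have h4 : Primrec fun k : ℕ => 2 * k + 4 :=
    Primrec.nat_add.comp (Primrec.nat_mul.comp (.const 2) .id) (.const 4)
  exact (Primrec.nat_mul.comp (Primrec.nat_mul.comp (Primrec.nat_mul.comp (.const 1200) h3)
    (hpow.comp (Primrec.nat_mul.comp (.const 8) h3) h4)) (hpow.comp h4 h4)).to_comp

theorem roundCost_le {n k W : ℕ} (hn : 0 < n) (hW : 0 < W) :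
    roundCost n k W ≤ 123 * ((k + 1) * W * n ^ 3) := by
  have e1 : W ≤ (k + 1) * W * n ^ 3 := by
    calc W = 1 * W * 1 := by ring
      _ ≤ (k + 1) * W * n ^ 3 := by gcongr; omega; exact Nat.one_le_pow _ _ hn
  have e2 : k + 1 ≤ (k + 1) * W * n ^ 3 := by
    calc k + 1 = (k + 1) * 1 * 1 := by ring
      _ ≤ (k + 1) * W * n ^ 3 := by gcongr; exact hW; exact Nat.one_le_pow _ _ hn
  have e3 : (k + 1) * W ≤ (k + 1) * W * n ^ 3 := Nat.le_mul_of_pos_right _ (by positivity)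
  have e4 : (k + 1) * n ^ 3 ≤ (k + 1) * W * n ^ 3 := by
    gcongr; exact Nat.le_mul_of_pos_right _ hW
  have e5 : (k + 1) * n ^ 2 ≤ (k + 1) * n ^ 3 := by gcongr; omega
  have e6 : (k + 1) * n ≤ (k + 1) * n ^ 3 := by gcongr; exact Nat.le_self_pow (by omega) n
  have e7 : n ≤ (k + 1) * n := Nat.le_mul_of_pos_left _ (by omega)
  -- The coefficients add up to `123`, and each monomial is at most `(k + 1) * W * n ^ 3`.
  have : roundCost n k W = 5 * W + 16 + 5 * ((k + 1) * W) + 57 * ((k + 1) * n ^ 2) +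
      14 * ((k + 1) * n) + 14 * (k + 1) + 7 * n + 5 * ((k + 1) * n ^ 3) := by
    unfold roundCost; ring
  omega

theorem cost_le {n k L : ℕ} (hn : 0 < n) (hL : 2 ^ L ≤ 2 * n) {B : ℕ} (hB : B = Arrays.base L k) :
    initCost n k B + (B ^ (k + 2) * (roundCost n k (B ^ (k + 2)) + 2) + 2 + ((n * n + n) * 5 + 3))
      ≤ paramCost k * n ^ 4 := by
  have hB0 : 0 < B := by rw [hB, Arrays.base]; omega
  set W := B ^ (k + 2)
  have hW : 0 < W := pow_pos hB0 _
  have hBW : B ≤ W := Nat.le_self_pow (by omega) B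
  -- `W` rounds, each of cost linear in `W`, produce the factor `W ^ 2`.
  have h1 : initCost n k B + (W * (roundCost n k W + 2) + 2 + ((n * n + n) * 5 + 3)) ≤
      300 * ((k + 2) ^ 2 * W ^ 2 * n ^ 3) := by
    have hn3 : 1 ≤ n ^ 3 := Nat.one_le_pow _ _ hn
    have hW2 : 1 ≤ W ^ 2 := Nat.one_le_pow _ _ hW
    have hk2 : 1 ≤ (k + 2) ^ 2 := Nat.one_le_pow _ _ (by omega)
    have hr := Nat.mul_le_mul_left W (roundCost_le (n := n) (k := k) hn hW)
    set X := (k + 2) ^ 2 * W ^ 2 * n ^ 3 with hX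
    have d0 : 1 ≤ X := Nat.mul_pos (Nat.mul_pos hk2 hW2) hn3
    have d1 : n ^ 3 ≤ X := Nat.le_mul_of_pos_left _ (Nat.mul_pos hk2 hW2)
    have d2 : n * n ≤ n ^ 3 := by rw [← sq]; exact Nat.pow_le_pow_right hn (by omega)
    have d3 : n ≤ n * n := Nat.le_mul_of_pos_left _ hn
    have d4 : (k + 2) ^ 2 * W ^ 2 ≤ X := Nat.le_mul_of_pos_right _ hn3
    have d5 : (k + 2) ^ 2 ≤ (k + 2) ^ 2 * W ^ 2 := Nat.le_mul_of_pos_right _ hW2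
    have d6 : W ^ 2 ≤ (k + 2) ^ 2 * W ^ 2 := Nat.le_mul_of_pos_left _ hk2
    have d7 : W ≤ W ^ 2 := Nat.le_self_pow (by omega) W
    have d8 : (k + 2) * W ≤ (k + 2) ^ 2 * W ^ 2 :=
      Nat.mul_le_mul (Nat.le_self_pow (by omega) _) d7
    have d9 : (k + 2) * B ≤ (k + 2) * W := Nat.mul_le_mul_left _ hBW
    have d10 : W * ((k + 1) * W * n ^ 3) ≤ X := by
      calc W * ((k + 1) * W * n ^ 3) = (k + 1) * W ^ 2 * n ^ 3 := by ring
        _ ≤ X := by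
          rw [hX]
          gcongr
          nlinarith
    have d11 : k + 2 ≤ (k + 2) ^ 2 := Nat.le_self_pow (by omega) _
    have d12 : (k + 1) * (k + 1) ≤ (k + 2) ^ 2 := by nlinarith
    have d13 : initCost n k B = n * 7 + 43 + (k + 1) * 3 + (k + 1) * (k + 1) * 3 +
      (3 * ((k + 2) * B) + 6 * (k + 2)) := by unfold initCost; ring
    have d14 : W * (roundCost n k W + 2) = W * roundCost n k W + 2 * W := by ring
    have d15 : W * (123 * ((k + 1) * W * n ^ 3)) = 123 * (W * ((k + 1) * W * n ^ 3)) := by ring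
    omega
  -- Here `B ≤ 8 * (k + 2)² * (L + 1)`, the power of `L + 1` is absorbed into `2 ^ (L + 1)`, and
  -- this is at most `4 * n`. The `4` turns `300` into `1200`, and the `n` turns `n ^ 3` into `n ^
  -- 4`.
  have h2 : W ^ 2 ≤ (8 * (k + 2) ^ 2) ^ (2 * k + 4) * (2 * k + 4) ^ (2 * k + 4) * (4 * n) := by
    calc W ^ 2 = B ^ (2 * k + 4) := by rw [← pow_mul]; ring_nf
      _ ≤ (8 * (k + 2) ^ 2 * (L + 1)) ^ (2 * k + 4) := by
        gcongr
        rw [hB, Arrays.base]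
        have : (k + 1) * (k + 1) ≤ (k + 2) ^ 2 := by nlinarith
        have h3 : L * ((k + 1) * (k + 1)) ≤ L * (k + 2) ^ 2 := Nat.mul_le_mul_left _ this
        have h4 : 1 ≤ (k + 2) ^ 2 := Nat.one_le_pow _ _ (by omega)
        nlinarith
      _ = (8 * (k + 2) ^ 2) ^ (2 * k + 4) * (L + 1) ^ (2 * k + 4) := mul_pow _ _ _
      _ ≤ (8 * (k + 2) ^ 2) ^ (2 * k + 4) * ((2 * k + 4) ^ (2 * k + 4) * 2 ^ (L + 1)) := by
        gcongr
        exact Nat.pow_le_pow_mul_two_pow _ (by omega)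
      _ ≤ (8 * (k + 2) ^ 2) ^ (2 * k + 4) * ((2 * k + 4) ^ (2 * k + 4) * (4 * n)) := by
        gcongr
        rw [pow_succ]
        omega
      _ = _ := by ring
  calc _ ≤ 300 * ((k + 2) ^ 2 * W ^ 2 * n ^ 3) := h1
    _ ≤ 300 * ((k + 2) ^ 2 * ((8 * (k + 2) ^ 2) ^ (2 * k + 4) * (2 * k + 4) ^ (2 * k + 4) *
        (4 * n)) * n ^ 3) := by gcongr
    _ = paramCost k * n ^ 4 := by unfold paramCost; ring

/-! ### The program solves the problem -/

/-- All working arrays lie beyond the input word, where the memory is zero, so they need no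
initialization. -/
theorem rep_initial (x : SPGInstance) :
    Rep x.n (fun e => (edgeBits {e | x.G.Adj e.1 e.2}).getD e 0) Arrays.zero
      (initial x.encode).mem := by
  have hlen : x.encode.length = 4 + x.n * x.n := by
    simp [SPGInstance.encode, length_edgeBits]
    omega
  have h0 : ∀ i, 4 + x.n * x.n ≤ i → (initial x.encode).mem i = 0 := fun i hi =>
    List.getD_eq_default _ _ (by omega)
  refine ⟨fun e _ => ?_, fun v _ => h0 _ (by omega), fun v _ => h0 _ (by omega),
    fun v _ => h0 _ (by omega), fun v _ => h0 _ (by omega), fun v _ => h0 _ (by omega)⟩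
  simp [initial, SPGInstance.encode, add_comm 4 e]

theorem halts_spg (x : SPGInstance) :
    Halts spg (initial x.encode) (paramCost x.k * wordSize x.encode ^ 4) fun τ =>
      τ.Outputs x.answer := by
  have hn : 0 < x.n := x.s.pos
  obtain ⟨L, hL, hL', hinit⟩ := halts_init (n := x.n) (s := x.s) (t := x.t) (k := x.k) hn
    (initial x.encode) rfl rfl rfl rfl
  have hB : 0 < Arrays.base L x.k := by rw [Arrays.base]; omega
  have hadj : ∀ u v : Fin x.n,
      (edgeBits {e | x.G.Adj e.1 e.2}).getD (u * x.n + v) 0 ≠ 0 ↔ x.G.Adj u v := by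
    intro u v
    obtain ⟨h1, h2⟩ := Arrays.mul_add_div_mod u v
    have h := Arrays.mul_add_lt u v
    rw [List.getD_eq_getElem _ _ (by rwa [length_edgeBits]), edgeBits_getElem _ h h1 h2]
    simp [propBit]
  refine (hinit.seq fun τ ⟨h1, h2⟩ => (halts_rounds h2 hB x.s.2 x.t.2
    (h1 ▸ rep_initial x)).seq fun υ ⟨k1, k2⟩ => halts_output (h2.congr k1) k2).mono
    ((cost_le hn hL' rfl).trans ?_) ?_
  · gcongr
    -- The adjacency matrix alone has `n * n ≥ n` entries, so `n` is at most the input size.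
    refine le_trans ?_ (length_le_wordSize _)
    have := Nat.le_mul_of_pos_left x.n hn
    simp [SPGInstance.encode, length_edgeBits]
    omega
  · rintro τ ⟨h0, hv, he⟩
    refine ⟨?_, fun i hi => ?_⟩
    · rw [h0, SPGInstance.answer, List.length_append, length_vertexBits, length_edgeBits, add_comm]
    · simp only [SPGInstance.answer, List.getElem_append, length_vertexBits]
      split_ifs with h
      · rw [hv i h, Arrays.final_vert hL hadj x.s_ne_t ⟨i, h⟩]
        simp [vertexBits]
      · rw [SPGInstance.answer, List.length_append, length_vertexBits, length_edgeBits] at hi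
        obtain ⟨e, rfl⟩ : ∃ e, i = x.n + e := ⟨i - x.n, by omega⟩
        have h3 : e < x.n * x.n := by omega
        have h4 := Arrays.final_edge (G := x.G) (s := x.s) (t := x.t) (k := x.k)
          (adj := fun e => (edgeBits {e | x.G.Adj e.1 e.2}).getD e 0) hL hadj
          ⟨e / x.n, Nat.div_lt_of_lt_mul h3⟩ ⟨e % x.n, Nat.mod_lt _ hn⟩
        simp only [Nat.div_add_mod'] at h4
        rw [he e h3, h4]
        simp only [Nat.add_sub_cancel_left]
        rw [edgeBits_getElem _ h3 (u := ⟨e / x.n, Nat.div_lt_of_lt_mul h3⟩)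
          (v := ⟨e % x.n, Nat.mod_lt _ hn⟩) rfl rfl]

end RAM

/-- The problem of `k`-hop-constrained `s`-`t` simple path graph generation, parameterized by the
hop constraint `k`, is fixed-parameter tractable. -/
theorem mainTheorem3 :
    FixedParameterTractable SPGInstance.encode SPGInstance.k SPGInstance.answer := by
  refine ⟨RAM.spg, RAM.paramCost, 4, RAM.computable_paramCost, fun x => ?_⟩
  obtain ⟨T, τ, h1, h2, h3⟩ := RAM.halts_spg x
  exact ⟨T, τ, h1, h3, h2⟩
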